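/- An interaction is a finite sequence of vertices. An interaction process assigns to each $i\in\mathbb N$ an interaction; its edge-labeled network is its equivalence class under bijective relabelings of the vertices that occur. A random edge-labeled network $\mathcal Y$ (with edges labeled by $\mathbb N$, and the $\sigma$-field generated by the restrictions to finitely many edges) is edge exchangeable if its law is invariant under all permutations of the edge labels, and blip-free if no interaction occurs exactly once. Vertices arrive in the order of their first occurrence, edge by edge and, within an edge, from left to right; a batch is the nonempty set of new vertices that one edge brings. The relative frequency of a vertex (of an edge) is the limiting proportion of the interactions that contain that vertex (that equal that edge). **Corollary 4.4.** Let $\mathcal Y$ be an edge exchangeable network that is blip-free with probability 1. (1) The vertices of $\mathcal Y$ arrive in size-biased order, weighted by their relative frequencies of occurrence. That is, on some probability space there are a random probability distribution $f=(f_s)$ on the finite sequences $s$ of elements of $\mathbb N$ and an interaction process $X_1,X_2,\dots$ with vertices labeled in $\mathbb N$ such that given $f$ the $X_i$ are i.i.d. with distribution $f$; the network induced by $X$ has the law of $\mathcal Y$; almost surely, every $v\in\mathbb N$ has relative frequency $$w_v=\lim_{n\to\infty}\frac1n\#\{i\le n: v\in X_i\}=\sum_{s\ni v}f_s ;$$ and,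 for every $k\ge 0$, given $f$ and the first $k$ batches of arriving vertices, with union $A$, each vertex $v\notin A$ belongs to the next batch with conditional probability $$\frac{w_v}{\sum_{s\not\subseteq A}f_s},$$ (read as $0$ if the denominator is $0$, in which case $w_v=0$), that is, with probability proportional to its relative frequency of occurrence. (2) Almost surely, for each $k\ge1$, the $k$-th vertex of $\mathcal Y$ in order of arrival has a relative frequency $W_k$ (with $W_k=0$ if there are fewer than $k$ vertices). (3) Consequently edge exchangeability is incompatible with vertex exchangeability: if $\mathcal Y$ has infinitely many vertices with positive probability, then, conditionally on this event, the vertices do not arrive in exchangeable order, in that the sequence $(W_1,W_2,\dots)$ is not exchangeable; and the vertex-labeled weighted hypergraph of $\mathcal Y$ (vertices labeled in order of arrival, each edge weighted by its relative frequency) is not vertex exchangeable, in that its law is not invariant under all permutations of the vertex labels. -/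

import Mathlib

open MeasureTheory ProbabilityTheory Filter Topology
open scoped NNReal ENNReal

namespace EdgeExch

/-! ### Interaction processes and edge-labeled networks

An interaction is a finite ordered multiset (a list) of vertices. A process with countably many
interactions involves only countably many vertices, so vertex labels in `ℕ` suffice. -/

/-- An interaction process `S → fin(ℕ)`. -/
abbrev Interactions (S : Type*) := S → List ℕ

/-- The (non-isolated) vertices of an interaction process. -/
def verts {S : Type*} (I : Interactions S) : Set ℕ := {v | ∃ i, v ∈ I i}

/-- Two interaction processes induce the same edge-labeled network if one is obtained from the other
by a bijective relabeling of the vertices that occur. -/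
def SameNetwork {S : Type*} (I J : Interactions S) : Prop :=
  ∃ ρ : ℕ → ℕ, Set.InjOn ρ (verts I) ∧ ∀ i, J i = (I i).map ρ

theorem sameNetwork_equivalence (S : Type*) : Equivalence (SameNetwork (S := S)) where
  refl I := ⟨id, Set.injOn_id _, fun i => by simp⟩
  symm := by
    rintro I J ⟨ρ, hρ, h⟩
    refine ⟨Function.invFunOn ρ (verts I), ?_, fun i => ?_⟩
    · rintro _ ⟨i, hi⟩ _ ⟨j, hj⟩ e
      rw [h, List.mem_map] at hi hj
      obtain ⟨u, hu, rfl⟩ := hi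
      obtain ⟨v, hv, rfl⟩ := hj
      rw [hρ.leftInvOn_invFunOn ⟨i, hu⟩, hρ.leftInvOn_invFunOn ⟨j, hv⟩] at e
      rw [e]
    · rw [h, List.map_map]
      symm
      conv_rhs => rw [← List.map_id (I i)]
      exact List.map_congr_left fun u hu => hρ.leftInvOn_invFunOn ⟨i, hu⟩
  trans := by
    rintro I J K ⟨ρ, hρ, h⟩ ⟨τ, hτ, k⟩
    refine ⟨τ ∘ ρ, ?_, fun i => by rw [k, h, List.map_map]⟩
    refine hτ.comp hρ ?_
    rintro v ⟨i, hi⟩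
    exact ⟨i, by rw [h]; exact List.mem_map_of_mem hi⟩

instance interactionsSetoid (S : Type*) : Setoid (Interactions S) := ⟨SameNetwork, sameNetwork_equivalence S⟩

/-- Edge-labeled networks with edges labeled by `S`. -/
def Network (S : Type*) := Quotient (interactionsSetoid S)

/-- The edge-labeled network induced by an interaction process. -/
def Interactions.network {S : Type*} (I : Interactions S) : Network S := Quotient.mk _ I

/-- Pulling the edges of a network back along a map of edge labels. -/
def Network.pullback {S T : Type*} (g : T → S) : Network S → Network T :=
  Quotient.map (fun I : Interactions S => fun t => I (g t)) (by
    rintro I J ⟨ρ, hρ, h⟩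
    exact ⟨ρ, hρ.mono (by rintro v ⟨t, ht⟩; exact ⟨g t, ht⟩), fun t => h (g t)⟩)

/-- The restriction of a network to its first `n` edges. -/
def Network.restrict (n : ℕ) : Network ℕ → Network (Fin n) := Network.pullback (fun i => (i : ℕ))

/-- The network with edges relabeled by `σ`: its edge `i` is the former edge `σ⁻¹ i`. -/
def Network.relabel {S : Type*} (σ : Equiv.Perm S) : Network S → Network S :=
  Network.pullback (fun i => σ⁻¹ i)

/-- The `σ`-field on networks generated by the restrictions to finitely many edges. As there are
countably many networks with `n` edges, it is the Borel `σ`-field of the metric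
`1 / (1 + sup {n | E and E' have the same restriction to the first n edges})`. -/
instance : MeasurableSpace (Network ℕ) :=
  ⨆ n : ℕ, MeasurableSpace.comap (Network.restrict n) ⊤

/-! ### Order of arrival -/

/-- `u` arrives strictly before `v`: some edge reached before or with the first edge of `v` contains
`u`, in a position before any occurrence of `v`. (`idxOf` is the length of the list for
a non-member.) -/
def ArrivesBefore (I : Interactions ℕ) (u v : ℕ) : Prop :=
  ∃ i, (∀ j < i, v ∉ I j) ∧ (I i).idxOf u < (I i).idxOf v

/-- The number of vertices that arrive strictly before `v`. -/
noncomputable def arrivalRank (I : Interactions ℕ) (v : ℕ) : ℕ := {u | ArrivesBefore I u v}.ncard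

theorem ArrivesBefore.mem_verts {I : Interactions ℕ} {u v : ℕ} (h : ArrivesBefore I u v) :
    u ∈ verts I := by
  obtain ⟨i, -, hi⟩ := h
  exact ⟨i, List.idxOf_lt_length_iff.1 (hi.trans_le List.idxOf_le_length)⟩

theorem idxOf_map_of_inj {ρ : ℕ → ℕ} {s : Set ℕ} (hρ : Set.InjOn ρ s) (l : List ℕ)
    (hl : ∀ x ∈ l, x ∈ s) {u : ℕ} (hu : u ∈ s) : (l.map ρ).idxOf (ρ u) = l.idxOf u := by
  induction l with
  | nil => simp
  | cons a l ih =>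
    have ha : a ∈ s := hl a (by simp)
    have hiff : ρ a = ρ u ↔ a = u := hρ.eq_iff ha hu
    have := ih (fun x hx => hl x (by simp [hx]))
    simp only [List.map_cons, List.idxOf_cons, this, beq_iff_eq, hiff, Bool.cond_eq_ite]

theorem arrivesBefore_map {I : Interactions ℕ} {ρ : ℕ → ℕ} (hρ : Set.InjOn ρ (verts I)) {u v : ℕ}
    (hu : u ∈ verts I) (hv : v ∈ verts I) :
    ArrivesBefore (fun i => (I i).map ρ) (ρ u) (ρ v) ↔ ArrivesBefore I u v := by
  have hl : ∀ i, ∀ x ∈ I i, x ∈ verts I := fun i x hx => ⟨i, hx⟩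
  have hm : ∀ j, ρ v ∈ (I j).map ρ ↔ v ∈ I j := fun j => by
    rw [List.mem_map]
    exact ⟨fun ⟨x, hx, e⟩ => hρ (hl j x hx) hv e ▸ hx, fun h => ⟨v, h, rfl⟩⟩
  simp only [ArrivesBefore, hm, idxOf_map_of_inj hρ _ (hl _) hu, idxOf_map_of_inj hρ _ (hl _) hv]

theorem arrivalRank_map {I : Interactions ℕ} {ρ : ℕ → ℕ} (hρ : Set.InjOn ρ (verts I)) {v : ℕ}
    (hv : v ∈ verts I) : arrivalRank (fun i => (I i).map ρ) (ρ v) = arrivalRank I v := by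
  have : {u | ArrivesBefore (fun i => (I i).map ρ) u (ρ v)} = ρ '' {u | ArrivesBefore I u v} := by
    ext w
    constructor
    · intro h
      obtain ⟨i, hi⟩ := h.mem_verts
      obtain ⟨u, hu, rfl⟩ := List.mem_map.1 hi
      exact ⟨u, (arrivesBefore_map hρ ⟨i, hu⟩ hv).1 h, rfl⟩
    · rintro ⟨u, hu, rfl⟩
      exact (arrivesBefore_map hρ hu.mem_verts hv).2 hu
  unfold arrivalRank
  rw [this]
  exact Set.InjOn.ncard_image (hρ.mono fun u hu => ArrivesBefore.mem_verts hu)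

/-- The canonical representative of a network: its vertices are labeled `0, 1, 2, …` in their order
of arrival. -/
noncomputable def Network.canon : Network ℕ → Interactions ℕ :=
  Quotient.lift (fun I : Interactions ℕ => fun i => (I i).map (arrivalRank I)) (by
    rintro I J ⟨ρ, hρ, h⟩
    obtain rfl : J = fun i => (I i).map ρ := funext h
    funext i
    simp only [List.map_map]
    exact List.map_congr_left fun v hv => (arrivalRank_map hρ ⟨i, hv⟩).symm)

theorem arrivalRank_injOn (I : Interactions ℕ) : Set.InjOn (arrivalRank I) (verts I) := by
  have irr : ∀ u, ¬ ArrivesBefore I u u := fun u ⟨i, _, h⟩ => lt_irrefl _ h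
  have tr : ∀ u v w, ArrivesBefore I u v → ArrivesBefore I v w → ArrivesBefore I u w := by
    rintro u v w ⟨i, hi, h⟩ ⟨j, hj, k⟩
    have hvj : v ∈ I j := List.idxOf_lt_length_iff.1 (k.trans_le List.idxOf_le_length)
    rcases lt_trichotomy i j with hij | rfl | hij
    · refine ⟨i, fun m hm => hj m (hm.trans hij), ?_⟩
      rw [List.idxOf_eq_length (hj i hij)]
      exact h.trans_le List.idxOf_le_length
    · exact ⟨i, hj, h.trans k⟩
    · exact absurd hvj (hi j hij)
  have fin : ∀ v ∈ verts I, {u | ArrivesBefore I u v}.Finite := by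
    rintro v ⟨k, hk⟩
    refine (Set.Finite.biUnion (Set.finite_Iic k) fun i _ => (I i).toFinset.finite_toSet).subset ?_
    rintro u ⟨i, hi, h⟩
    simp only [Set.mem_iUnion]
    refine ⟨i, not_lt.1 fun hki => hi k hki hk, ?_⟩
    simpa using List.idxOf_lt_length_iff.1 (h.trans_le List.idxOf_le_length)
  have tri : ∀ u ∈ verts I, ∀ v ∈ verts I, u ≠ v → ArrivesBefore I u v ∨ ArrivesBefore I v u := by
    intro u hu v hv huv
    classical
    have hu1 := Nat.find_spec hu
    have hv1 := Nat.find_spec hv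
    have hu2 : ∀ j < Nat.find hu, u ∉ I j := fun j => Nat.find_min hu
    have hv2 : ∀ j < Nat.find hv, v ∉ I j := fun j => Nat.find_min hv
    rcases lt_trichotomy (Nat.find hu) (Nat.find hv) with h | h | h
    · refine .inl ⟨_, fun j hj => hv2 j (hj.trans h), ?_⟩
      rw [List.idxOf_eq_length (hv2 _ h)]
      exact List.idxOf_lt_length_iff.2 hu1
    · rcases lt_trichotomy ((I (Nat.find hu)).idxOf u) ((I (Nat.find hu)).idxOf v) with k | k | k
      · exact .inl ⟨_, h ▸ hv2, k⟩
      · exact absurd ((List.idxOf_inj hu1).1 k) huv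
      · exact .inr ⟨_, hu2, k⟩
    · refine .inr ⟨_, fun j hj => hu2 j (hj.trans h), ?_⟩
      rw [List.idxOf_eq_length (hu2 _ h)]
      exact List.idxOf_lt_length_iff.2 hv1
  have lt : ∀ u, ∀ v ∈ verts I, ArrivesBefore I u v → arrivalRank I u < arrivalRank I v :=
    fun u v hv h => Set.ncard_lt_ncard
      ⟨fun w hw => tr w u v hw h, fun hs => irr u (hs h)⟩ (fin v hv)
  intro u hu v hv e
  by_contra huv
  rcases tri u hu v hv huv with h | h
  · exact (lt u v hv h).ne e
  · exact (lt v u hu h).ne e.symm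

/-- The canonical representative is indeed a representative. -/
theorem Network.network_canon (E : Network ℕ) : Interactions.network E.canon = E := by
  induction E using Quotient.inductionOn with
  | _ I =>
    have h : SameNetwork I (fun i => (I i).map (arrivalRank I)) :=
      ⟨arrivalRank I, arrivalRank_injOn I, fun _ => rfl⟩
    exact (Quotient.sound h).symm

/-! ### Blips and edge exchangeability -/

/-- No interaction occurs exactly once. -/
def Network.BlipFree (E : Network ℕ) : Prop := ∀ i, ∃ j, j ≠ i ∧ E.canon j = E.canon i

theorem blipFree_network (I : Interactions ℕ) :
    I.network.BlipFree ↔ ∀ i, ∃ j, j ≠ i ∧ I j = I i := by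
  refine forall_congr' fun i => exists_congr fun j => and_congr_right fun _ => ?_
  change (I j).map (arrivalRank I) = (I i).map (arrivalRank I) ↔ _
  refine ⟨fun h => ?_, fun h => by rw [h]⟩
  have key : ∀ m, ((I m).map (arrivalRank I)).map
      (Function.invFunOn (arrivalRank I) (verts I)) = I m := fun m => by
    rw [List.map_map]
    conv_rhs => rw [← List.map_id (I m)]
    exact List.map_congr_left fun u hu => (arrivalRank_injOn I).leftInvOn_invFunOn ⟨m, hu⟩
  rw [← key j, h, key]

/-- The random network `Y` is edge exchangeable under `μ`. -/
def EdgeExchangeable {Ω : Type*} [MeasurableSpace Ω] (μ : Measure Ω) (Y : Ω → Network ℕ) : Prop :=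
  ∀ σ : Equiv.Perm ℕ, μ.map (fun ω => (Y ω).relabel σ) = μ.map Y

/-! ### Relative frequencies -/

/-- The proportion of those among the indices `0, …, n - 1` that satisfy `p`. -/
noncomputable def proportion (p : ℕ → Prop) (n : ℕ) : ℝ := ({i | i < n ∧ p i}.ncard : ℝ) / n

/-- The long-run relative frequency of `p` (the limit of the proportions whenever it exists). -/
noncomputable def relFreq (p : ℕ → Prop) : ℝ := limsup (proportion p) atTop

/-- The relative frequency of occurrence of the vertex that arrives after exactly `k` others
(`0` if there is none): the long-run proportion of edges that contain it. -/
noncomputable def Network.arrivalFreq (E : Network ℕ) (k : ℕ) : ℝ := relFreq fun i => k ∈ E.canon i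

/-- The relative frequency of the edge `s`, vertices being labeled in order of arrival. -/
noncomputable def Network.edgeFreq (E : Network ℕ) (s : List ℕ) : ℝ :=
  relFreq fun i => E.canon i = s

/-! ### Random interactions -/

/-- The simplex of probability distributions `(f_s)` on `fin(ℕ)`. -/
abbrev Simplex := {f : List ℕ → ℝ≥0 // HasSum f 1}

/-- Given `f`, the interactions `X 0, X 1, …` are i.i.d. with distribution `f`. -/
structure IIDGiven {Ω : Type*} [MeasurableSpace Ω] (P : Measure Ω) (f : Ω → Simplex)
    (X : Ω → Interactions ℕ) : Prop where
  measurable_f : Measurable f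
  measurable_X : ∀ (i : ℕ) (s : List ℕ), MeasurableSet {ω | X ω i = s}
  law : ∀ C : Set Simplex, MeasurableSet C → ∀ (n : ℕ) (s : Fin n → List ℕ),
    P {ω | f ω ∈ C ∧ ∀ i : Fin n, X ω i = s i} =
      ∫⁻ ω in f ⁻¹' C, ∏ i, ((f ω).1 (s i) : ℝ≥0∞) ∂P

open Classical in
/-- The weight of the vertex `v` under `f`: the mass of the edges that contain `v`. -/
noncomputable def weight (f : Simplex) (v : ℕ) : ℝ≥0 := ∑' s : List ℕ, if v ∈ s then f.1 s else 0

open Classical in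
/-- The mass, under `f`, of the edges that contain some vertex outside `A`. -/
noncomputable def newMass (f : Simplex) (A : Finset ℕ) : ℝ≥0 :=
  ∑' s : List ℕ, if ∃ u ∈ s, u ∉ A then f.1 s else 0

/-! ### Size-biased arrivals -/

/-- The vertices whose first occurrence is in edge `i`. -/
def newVerts (x : Interactions ℕ) (i : ℕ) : Set ℕ := {v | v ∈ x i ∧ ∀ j < i, v ∉ x j}

open Classical in
/-- The `k`-th batch of arriving vertices (`k = 0, 1, …`): the new vertices in that edge with new
vertices which is preceded by exactly `k` other edges with new vertices. It is empty if there are at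
most `k` edges with new vertices. -/
noncomputable def batch (x : Interactions ℕ) (k : ℕ) : Set ℕ :=
  {v | ∃ i, v ∈ newVerts x i ∧ Nat.count (fun j => (newVerts x j).Nonempty) i = k}

/-- The vertices arrive in size-biased order with weights `weight f`: given `f` and the first `k`
batches `A 0, …, A (k - 1)` of arrivals, each vertex `v` that has not arrived is among the next
arrivals with conditional probability `weight f v / newMass f (⋃ j, A j)`, which is proportional to
its weight. (If the denominator vanishes, so does the numerator, and the quotient is `0`.) -/
def SizeBiasedArrival {Ω : Type*} [MeasurableSpace Ω] (P : Measure Ω) (f : Ω → Simplex)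
    (X : Ω → Interactions ℕ) : Prop :=
  ∀ C : Set Simplex, MeasurableSet C → ∀ (k : ℕ) (A : Fin k → Finset ℕ) (v : ℕ), (∀ j, v ∉ A j) →
    P {ω | f ω ∈ C ∧ (∀ j : Fin k, batch (X ω) j = A j) ∧ v ∈ batch (X ω) k} =
      ∫⁻ ω in {ω | f ω ∈ C ∧ ∀ j : Fin k, batch (X ω) j = A j},
        (weight (f ω) v : ℝ≥0∞) / (newMass (f ω) (Finset.univ.biUnion A) : ℝ≥0∞) ∂P

/-! ### Vertex exchangeability -/

/-- The vertices arrive in exchangeable order: the sequence of their relative frequencies, in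
order of arrival, is exchangeable. -/
def ExchangeableArrival {Ω : Type*} [MeasurableSpace Ω] (μ : Measure Ω) (Y : Ω → Network ℕ) :
    Prop :=
  ∀ π : Equiv.Perm ℕ,
    μ.map (fun ω => fun k => (Y ω).arrivalFreq (π k)) = μ.map (fun ω => (Y ω).arrivalFreq)

/-- The vertex-labeled weighted hypergraph of `Y` (vertices labeled in order of arrival, each edge
weighted by its relative frequency) is vertex exchangeable: its law is invariant under relabeling
the vertices. -/
def VertexExchangeable {Ω : Type*} [MeasurableSpace Ω] (μ : Measure Ω) (Y : Ω → Network ℕ) :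
    Prop :=
  ∀ π : Equiv.Perm ℕ,
    μ.map (fun ω => fun s : List ℕ => (Y ω).edgeFreq (s.map π)) = μ.map (fun ω => (Y ω).edgeFreq)

end EdgeExch

namespace EdgeExch

/-! A network is studied through `Network.canon`, whose vertex labels depend on the order of the
edges. Exchangeability therefore speaks only of events that do not depend on vertex labels, such as
equality of two edges: any `n` distinct edges satisfy such a condition with the same probability
(`ExchLaw.measure_injective`).

Frequencies of edges. For fixed `m`, the events that a later edge equals edge `m` are pairwise
exchangeable, so an L² law of large numbers (`ae_exists_tendsto_proportion`) gives every edge a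
limiting frequency almost surely. The total frequency is at most 1. Its expectation bounds from
above the probability that edge `K` repeats one of the edges before it. By exchangeability this is
the probability that edge 0 recurs among the next `K` edges, which tends to 1 because there are no
blips. Hence the frequencies add up to 1. The edges of frequency zero then form a vanishing
proportion, and exchangeability makes each of them impossible. This is `ExchLaw.ae_regular`.

Representation. Let `f` be the frequencies of the edges and sample i.i.d. edges from `f`. Averaging
an event about the first `n` edges over index tuples taken from disjoint blocks leaves its
probability unchanged, while the averages converge to the probability of the event under `f^n`. So
the sampled network has the original law (`ExchLaw.map_network_eq`). Only the network is recovered: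
the labels in `f` are those of arrival in the given network, not in the sample.

Size bias. Suppose that just before edge `i` exactly the batches `A` have arrived. This concerns
earlier edges only, and edge `i` is independent of them. It contains `v` with probability `weight f
v`, and brings anything new with probability `newMass f (⋃ A)`. Summing over `i`, both probabilities
acquire the same factor, and their ratio is the claim (`Simplex.iidLaw_batchesEq_inter_mem`).

Incompatibility. Either form of vertex exchangeability gives all arrival frequencies the same mean.
These frequencies are at most 1 and tend to 0 along the order of arrival, so the mean is 0 and all
of them vanish almost surely. But in a regular network a vertex that occurs has positive frequency.
-/

instance : MeasurableSpace (List ℕ) := ⊤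

instance : DiscreteMeasurableSpace (List ℕ) := ⟨fun _ => trivial⟩

/-! ### Canonical representatives and finite restrictions -/

/-- The process with all edges from `n` on replaced by the empty edge. -/
def trunc (n : ℕ) (I : Interactions ℕ) : Interactions ℕ := fun i => if i < n then I i else []

/-- The edge witnessing `ArrivesBefore` cannot come after an edge that contains `v`, so edges beyond
`i` are irrelevant. -/
theorem arrivesBefore_trunc {n i : ℕ} (hi : i < n) {I : Interactions ℕ} {u v : ℕ} (hv : v ∈ I i) :
    ArrivesBefore (trunc n I) u v ↔ ArrivesBefore I u v := by
  have ht : ∀ j, j < n → trunc n I j = I j := fun j hj => if_pos hj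
  constructor
  · rintro ⟨j, hj, h⟩
    have hji : j ≤ i := by
      by_contra hc
      exact hj i (not_le.1 hc) (by rwa [ht i hi])
    refine ⟨j, fun m hm => ?_, ?_⟩
    · rw [← ht m (by omega)]; exact hj m hm
    · rwa [ht j (by omega)] at h
  · rintro ⟨j, hj, h⟩
    have hji : j ≤ i := by
      by_contra hc
      exact hj i (not_le.1 hc) hv
    refine ⟨j, fun m hm => ?_, ?_⟩
    · rw [ht m (by omega)]; exact hj m hm
    · rwa [ht j (by omega)]

theorem arrivalRank_trunc {n i : ℕ} (hi : i < n) {I : Interactions ℕ} {v : ℕ} (hv : v ∈ I i) :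
    arrivalRank (trunc n I) v = arrivalRank I v := by
  unfold arrivalRank
  simp only [arrivesBefore_trunc hi hv]

theorem sameNetwork_canon_network (I : Interactions ℕ) : SameNetwork I I.network.canon :=
  ⟨arrivalRank I, arrivalRank_injOn I, fun _ => rfl⟩

theorem map_inj_of_injOn {ρ : ℕ → ℕ} {s : Set ℕ} (hρ : Set.InjOn ρ s) {l m : List ℕ}
    (hl : ∀ x ∈ l, x ∈ s) (hm : ∀ x ∈ m, x ∈ s) : l.map ρ = m.map ρ ↔ l = m := by
  refine ⟨fun h => ?_, fun h => by rw [h]⟩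
  have key : ∀ k : List ℕ, (∀ x ∈ k, x ∈ s) → (k.map ρ).map (Function.invFunOn ρ s) = k := by
    intro k hk
    rw [List.map_map]
    conv_rhs => rw [← List.map_id k]
    exact List.map_congr_left fun u hu => hρ.leftInvOn_invFunOn (hk u hu)
  rw [← key l hl, h, key m hm]

/-- Coincidence of edges is a property of the network; it is the source of all events to which
exchangeability is applied in the study of frequencies. -/
theorem SameNetwork.eq_iff {S : Type*} {I J : Interactions S} (h : SameNetwork I J) (i j : S) :
    I i = I j ↔ J i = J j := by
  obtain ⟨ρ, hρ, h⟩ := h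
  rw [h, h, map_inj_of_injOn hρ (fun x hx => ⟨i, hx⟩) (fun x hx => ⟨j, hx⟩)]

/-- Arrival labels in the first `n` edges are decided by those edges, which makes canonical edges
measurable. The relabeling `ρ` is injective only on vertices of the first `n` edges; truncation
discards the others, so that `arrivalRank_map` applies. -/
theorem canon_eq_of_restrict_eq {n : ℕ} {E F : Network ℕ} (h : E.restrict n = F.restrict n)
    {i : ℕ} (hi : i < n) : E.canon i = F.canon i := by
  induction E using Quotient.inductionOn with
  | _ I =>
  induction F using Quotient.inductionOn with
  | _ J =>
    obtain ⟨ρ, hρ, hJ⟩ : SameNetwork (fun t : Fin n => I t) (fun t : Fin n => J t) :=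
      Quotient.exact h
    have hv : verts (trunc n I) ⊆ verts (fun t : Fin n => I t) := by
      rintro v ⟨j, hj⟩
      unfold trunc at hj
      split_ifs at hj with hjn
      · exact ⟨⟨j, hjn⟩, hj⟩
      · simp at hj
    have ht : trunc n J = fun j => (trunc n I j).map ρ := by
      funext j
      unfold trunc
      split_ifs with hjn
      · exact hJ ⟨j, hjn⟩
      · rfl
    change (I i).map (arrivalRank I) = (J i).map (arrivalRank J)
    have hJi : J i = (I i).map ρ := hJ ⟨i, hi⟩
    rw [hJi, List.map_map]
    refine List.map_congr_left fun v hvi => ?_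
    have hvi' : v ∈ verts (trunc n I) := ⟨i, by unfold trunc; rwa [if_pos hi]⟩
    have h1 : ρ v ∈ J i := by rw [hJi]; exact List.mem_map_of_mem hvi
    rw [Function.comp_apply, ← arrivalRank_trunc hi hvi, ← arrivalRank_trunc hi h1, ht]
    exact (arrivalRank_map (hρ.mono hv) hvi').symm

/-! ### Measurability -/

theorem measurableSet_of_restrict (n : ℕ) {s : Set (Network ℕ)}
    (h : ∀ E F : Network ℕ, E.restrict n = F.restrict n → E ∈ s → F ∈ s) : MeasurableSet s := by
  have : s = Network.restrict n ⁻¹' (Network.restrict n '' s) := by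
    ext F
    constructor
    · exact fun hF => ⟨F, hF, rfl⟩
    · rintro ⟨E, hE, hEF⟩
      exact h E F hEF hE
  rw [this]
  exact MeasurableSpace.measurableSet_iSup.2 (.basic _ ⟨n, _, trivial, rfl⟩)

theorem measurable_canon_apply (i : ℕ) : Measurable fun E : Network ℕ => E.canon i := by
  intro B _
  refine measurableSet_of_restrict (i + 1) fun E F h hE => ?_
  rw [Set.mem_preimage, ← canon_eq_of_restrict_eq h (Nat.lt_succ_self i)]
  exact hE

theorem measurable_of_restrict {Ω : Type*} [MeasurableSpace Ω] {g : Ω → Network ℕ}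
    (h : ∀ n (B : Set (Network (Fin n))), MeasurableSet {ω | (g ω).restrict n ∈ B}) :
    Measurable g := by
  refine measurable_iff_le_map.2 (iSup_le fun n => ?_)
  rintro _ ⟨B, -, rfl⟩
  exact h n B

instance (n : ℕ) : Countable (Network (Fin n)) :=
  inferInstanceAs (Countable (Quotient (interactionsSetoid (Fin n))))

theorem measurable_network : Measurable (Interactions.network : (ℕ → List ℕ) → Network ℕ) := by
  refine measurable_of_restrict fun n B => ?_
  have h : Measurable fun I : ℕ → List ℕ => fun t : Fin n => I t := by fun_prop
  exact h (MeasurableSet.of_discrete (s := {I : Fin n → List ℕ | Interactions.network I ∈ B}))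

theorem relabel_eq (σ : Equiv.Perm ℕ) (E : Network ℕ) :
    E.relabel σ = Interactions.network fun i => E.canon (σ⁻¹ i) := by
  conv_lhs => rw [← E.network_canon]
  rfl

theorem restrict_eq (n : ℕ) (E : Network ℕ) :
    E.restrict n = Interactions.network fun i : Fin n => E.canon i := by
  conv_lhs => rw [← E.network_canon]
  rfl

theorem measurable_relabel (σ : Equiv.Perm ℕ) : Measurable (Network.relabel (S := ℕ) σ) := by
  have : Network.relabel σ = fun E => Interactions.network fun i => E.canon (σ⁻¹ i) :=
    funext fun E => relabel_eq σ E
  rw [this]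
  exact measurable_network.comp (measurable_pi_lambda _ fun i => measurable_canon_apply _)

/-- Two laws on networks with the same finite-dimensional distributions agree. -/
theorem ext_of_restrict {ν ν' : Measure (Network ℕ)} [IsProbabilityMeasure ν]
    [IsProbabilityMeasure ν'] (h : ∀ n (F : Network (Fin n)),
      ν {E | E.restrict n = F} = ν' {E | E.restrict n = F}) : ν = ν' := by
  have hB : ∀ n (B : Set (Network (Fin n))),
      ν {E | E.restrict n ∈ B} = ν' {E | E.restrict n ∈ B} := by
    intro n B
    have hu : {E : Network ℕ | E.restrict n ∈ B} = ⋃ F ∈ B, {E | E.restrict n = F} := by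
      ext E; simp
    have hd : B.PairwiseDisjoint fun F => {E : Network ℕ | E.restrict n = F} := by
      intro F _ G _ hFG
      exact Set.disjoint_left.2 fun E (h1 : _ = _) (h2 : _ = _) => hFG (h1.symm.trans h2)
    have hm : ∀ F ∈ B, MeasurableSet {E : Network ℕ | E.restrict n = F} := fun F _ =>
      measurableSet_of_restrict n fun E G h (hE : _ = _) => show _ = _ from h ▸ hE
    rw [hu, measure_biUnion B.to_countable hd hm, measure_biUnion B.to_countable hd hm]
    exact tsum_congr fun F => h n F
  refine MeasureTheory.ext_of_generate_finite
    {s | ∃ n, ∃ B : Set (Network (Fin n)), s = {E | E.restrict n ∈ B}} ?_ ?_ ?_ ?_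
  · refine le_antisymm (iSup_le fun n => ?_) (MeasurableSpace.generateFrom_le ?_)
    · rintro _ ⟨B, -, rfl⟩
      exact MeasurableSpace.measurableSet_generateFrom ⟨n, B, rfl⟩
    · rintro _ ⟨n, B, rfl⟩
      exact measurableSet_of_restrict n fun E F h hE => by
        rw [Set.mem_ofPred_eq] at hE ⊢; rwa [← h]
  · rintro _ ⟨n, B, rfl⟩ _ ⟨m, C, rfl⟩ -
    -- Conditions on the first `n` and on the first `m` edges are jointly a condition on the first
    -- `n + m`, whence a π-system.
    refine ⟨n + m, {F | F.pullback (Fin.castAdd m) ∈ B ∧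
      F.pullback (fun i : Fin m => Fin.castLE (Nat.le_add_left m n) i) ∈ C}, ?_⟩
    ext E
    induction E using Quotient.inductionOn with
    | _ I => rfl
  · rintro _ ⟨n, B, rfl⟩
    exact hB n B
  · simp

/-! ### Exchangeability -/

/-- A law on networks which is invariant under all relabelings of the edges. -/
def ExchLaw (ν : Measure (Network ℕ)) : Prop :=
  ∀ σ : Equiv.Perm ℕ, ν.map (Network.relabel σ) = ν

theorem EdgeExchangeable.exchLaw {Ω : Type*} [MeasurableSpace Ω] {μ : Measure Ω}
    {Y : Ω → Network ℕ} (hY : Measurable Y) (h : EdgeExchangeable μ Y) : ExchLaw (μ.map Y) := by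
  intro σ
  rw [Measure.map_map (measurable_relabel σ) hY]
  exact h σ

/-- Permuting the edges of the canonical representative gives only some representative of the
relabeled network, since the order of arrival changes. Invariance of `Q` under `SameNetwork` absorbs
the difference. -/
theorem ExchLaw.measure_perm {ν : Measure (Network ℕ)} (hν : ExchLaw ν)
    {Q : Interactions ℕ → Prop} (hQ : ∀ I J, SameNetwork I J → (Q I ↔ Q J))
    (hm : MeasurableSet {E : Network ℕ | Q E.canon}) (σ : Equiv.Perm ℕ) :
    ν {E | Q fun i => E.canon (σ i)} = ν {E | Q E.canon} := by
  conv_rhs => rw [← hν σ⁻¹, Measure.map_apply (measurable_relabel _) hm]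
  congr 1
  ext E
  simp only [Set.mem_ofPred_eq, Set.mem_preimage]
  rw [relabel_eq, inv_inv]
  exact hQ _ _ (sameNetwork_canon_network _)

theorem SameNetwork.comp {S T : Type*} {I J : Interactions S} (h : SameNetwork I J) (g : T → S) :
    SameNetwork (fun t => I (g t)) (fun t => J (g t)) := by
  obtain ⟨ρ, hρ, h⟩ := h
  exact ⟨ρ, hρ.mono (by rintro v ⟨t, ht⟩; exact ⟨g t, ht⟩), fun t => h (g t)⟩

theorem exists_perm_extending {n : ℕ} {τ τ' : Fin n → ℕ} (hτ : Function.Injective τ)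
    (hτ' : Function.Injective τ') : ∃ σ : Equiv.Perm ℕ, ∀ i, σ (τ i) = τ' i := by
  obtain ⟨σ, hσ⟩ := (Equiv.Perm.isMultiplyPretransitive ℕ n).exists_smul_eq
    ⟨τ, hτ⟩ ⟨τ', hτ'⟩
  exact ⟨σ, fun i => DFunLike.congr_fun hσ i⟩

theorem ExchLaw.measure_injective {ν : Measure (Network ℕ)} (hν : ExchLaw ν) {n : ℕ}
    {Q : Interactions (Fin n) → Prop} (hQ : ∀ I J, SameNetwork I J → (Q I ↔ Q J))
    {τ τ' : Fin n → ℕ} (hτ : Function.Injective τ) (hτ' : Function.Injective τ') :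
    ν {E | Q fun i => E.canon (τ i)} = ν {E | Q fun i => E.canon (τ' i)} := by
  obtain ⟨σ, hσ⟩ := exists_perm_extending hτ' hτ
  have hm : Measurable fun E : Network ℕ => fun i : Fin n => E.canon (τ' i) :=
    measurable_pi_lambda _ fun i => measurable_canon_apply _
  have := hν.measure_perm (Q := fun I => Q fun i => I (τ' i)) (fun I J h => hQ _ _ (h.comp τ'))
    (hm (MeasurableSet.of_discrete (s := {I : Fin n → List ℕ | Q I}))) σ
  simpa only [hσ] using this

/-! ### Empirical averages -/

open Classical in
/-- The real-valued indicator of a proposition. -/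
noncomputable def ind (p : Prop) : ℝ := if p then 1 else 0

theorem ind_of_true {p : Prop} (h : p) : ind p = 1 := if_pos h

theorem ind_of_false {p : Prop} (h : ¬ p) : ind p = 0 := if_neg h

theorem ind_nonneg (p : Prop) : 0 ≤ ind p := by
  unfold ind; split_ifs <;> norm_num

theorem ind_le_one (p : Prop) : ind p ≤ 1 := by
  unfold ind; split_ifs <;> norm_num

theorem ind_and (p q : Prop) : ind (p ∧ q) = ind p * ind q := by
  by_cases hp : p <;> by_cases hq : q <;> simp [ind, hp, hq]

theorem ind_mono {p q : Prop} (h : p → q) : ind p ≤ ind q := by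
  by_cases hp : p
  · rw [ind_of_true hp, ind_of_true (h hp)]
  · rw [ind_of_false hp]; exact ind_nonneg q

theorem ind_eq_indicator {Ω : Type*} (p : Ω → Prop) :
    (fun ω => ind (p ω)) = Set.indicator {ω | p ω} (fun _ => (1 : ℝ)) := by
  funext ω
  by_cases h : p ω <;> simp [ind, Set.indicator, h]

section Measure

variable {Ω : Type*} [MeasurableSpace Ω] {P : Measure Ω} {p : Ω → Prop}

theorem measurable_ind (h : MeasurableSet {ω | p ω}) : Measurable fun ω => ind (p ω) := by
  rw [ind_eq_indicator]
  exact measurable_const.indicator h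

theorem integral_ind (h : MeasurableSet {ω | p ω}) : ∫ ω, ind (p ω) ∂P = P.real {ω | p ω} := by
  rw [ind_eq_indicator, integral_indicator_const _ h, smul_eq_mul, mul_one]

theorem integrable_ind [IsFiniteMeasure P] (h : MeasurableSet {ω | p ω}) :
    Integrable (fun ω => ind (p ω)) P := by
  rw [ind_eq_indicator]
  exact (integrable_const _).indicator h

end Measure

/-- The average of the indicators of `p` over a finite set. -/
noncomputable def avg {T : Type*} (S : Finset T) (p : T → Prop) : ℝ := (∑ t ∈ S, ind (p t)) / S.card

section Avg

variable {T : Type*} (S : Finset T) {p q : T → Prop}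

theorem avg_nonneg : 0 ≤ avg S p :=
  div_nonneg (Finset.sum_nonneg fun _ _ => ind_nonneg _) (Nat.cast_nonneg _)

theorem avg_mono (h : ∀ t, p t → q t) : avg S p ≤ avg S q :=
  div_le_div_of_nonneg_right (Finset.sum_le_sum fun t _ => ind_mono (h t)) (Nat.cast_nonneg _)

theorem avg_le_one : avg S p ≤ 1 := by
  refine div_le_one_of_le₀ ?_ (Nat.cast_nonneg _)
  refine (Finset.sum_le_sum fun t _ => ind_le_one (p t)).trans ?_
  simp

theorem avg_add_of_disjoint (h : ∀ t, p t → ¬ q t) :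
    avg S (fun t => p t ∨ q t) = avg S p + avg S q := by
  unfold avg
  rw [← add_div, ← Finset.sum_add_distrib]
  congr 1
  refine Finset.sum_congr rfl fun t _ => ?_
  by_cases hp : p t
  · simp [ind, hp, h t hp]
  · by_cases hq : q t <;> simp [ind, hp, hq]

theorem avg_mem_finset {U : Type*} (z : T → U) (F : Finset U) :
    avg S (fun t => z t ∈ F) = ∑ s ∈ F, avg S (fun t => z t = s) := by
  classical
  unfold avg
  rw [← Finset.sum_div, Finset.sum_comm]
  congr 1
  refine Finset.sum_congr rfl fun t _ => ?_
  by_cases h : z t ∈ F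
  · rw [ind_of_true h, Finset.sum_eq_single_of_mem _ h fun b _ hb => ind_of_false (Ne.symm hb),
      ind_of_true rfl]
  · rw [ind_of_false h, Finset.sum_eq_zero fun b hb => ind_of_false ?_]
    rintro rfl
    exact h hb

end Avg

theorem proportion_eq_avg (p : ℕ → Prop) (n : ℕ) : proportion p n = avg (Finset.range n) p := by
  classical
  unfold proportion avg
  have : {i | i < n ∧ p i} = ((Finset.range n).filter p : Set ℕ) := by
    ext i; simp
  rw [this, Set.ncard_coe_finset, Finset.card_filter, Finset.card_range]
  push_cast
  congr 1

/-- Pointwise convergence of the relative frequencies of an empirical law to a probability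
distribution entails convergence of the relative frequencies of all sets. -/
theorem tendsto_avg_mem {T U : Type*} {S : ℕ → Finset T} {z : T → U} {f : U → ℝ}
    (hS : ∀ᶠ N in atTop, (S N).Nonempty) (hf : HasSum f 1)
    (h : ∀ s, Tendsto (fun N => avg (S N) fun t => z t = s) atTop (𝓝 (f s))) (B : Set U) :
    Tendsto (fun N => avg (S N) fun t => z t ∈ B) atTop (𝓝 (∑' s, B.indicator f s)) := by
  classical
  have hf0 : ∀ s, 0 ≤ f s := fun s => ge_of_tendsto' (h s) fun N => avg_nonneg _
  have hB : Summable (B.indicator f) := hf.summable.indicator B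
  rw [Metric.tendsto_atTop']
  intro ε hε
  -- A finite set carrying all but `ε / 4` of the limiting mass prevents mass from escaping.
  obtain ⟨F, hF⟩ := ((Metric.tendsto_atTop.1 hf) (ε / 4) (by positivity))
  have hF1 := hF F le_rfl
  have hFle : ∑ s ∈ F, f s ≤ 1 := sum_le_hasSum F (fun s _ => hf0 s) hf
  rw [Real.dist_eq, abs_lt] at hF1
  have hlim : ∀ G : Finset U, Tendsto (fun N => avg (S N) fun t => z t ∈ G) atTop
      (𝓝 (∑ s ∈ G, f s)) := fun G => by
    simp only [avg_mem_finset]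
    exact tendsto_finsetSum _ fun s _ => h s
  set G := F.filter (· ∈ B)
  have hG : ∑ s ∈ G, f s = ∑ s ∈ F, B.indicator f s := by
    rw [Finset.sum_filter]
    exact Finset.sum_congr rfl fun s _ => by simp [Set.indicator]
  have h1 : ∑ s ∈ G, f s ≤ ∑' s, B.indicator f s := by
    rw [hG]
    exact hB.sum_le_tsum F fun s _ => Set.indicator_nonneg (fun _ _ => hf0 _) _
  have h2 : ∑' s, B.indicator f s ≤ ∑ s ∈ G, f s + ε / 4 := by
    have hc : Summable (Bᶜ.indicator f) := hf.summable.indicator Bᶜ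
    have e1 : ∑' s, B.indicator f s + ∑' s, Bᶜ.indicator f s = 1 := by
      rw [← hB.tsum_add hc, ← hf.tsum_eq]
      exact tsum_congr fun s => congrFun (Set.indicator_self_add_compl B f) s
    have e2 : ∑ s ∈ F, B.indicator f s + ∑ s ∈ F, Bᶜ.indicator f s = ∑ s ∈ F, f s := by
      rw [← Finset.sum_add_distrib]
      exact Finset.sum_congr rfl fun s _ => congrFun (Set.indicator_self_add_compl B f) s
    have e3 := hc.sum_le_tsum F fun s _ => Set.indicator_nonneg (fun _ _ => hf0 _) s
    rw [hG]
    linarith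
  obtain ⟨N1, hN1⟩ := (Metric.tendsto_atTop.1 (hlim G)) (ε / 4) (by positivity)
  obtain ⟨N2, hN2⟩ := (Metric.tendsto_atTop.1 (hlim F)) (ε / 4) (by positivity)
  obtain ⟨N3, hN3⟩ := eventually_atTop.1 hS
  refine ⟨max N1 (max N2 N3), fun N hN => ?_⟩
  have a1 := hN1 N (by omega)
  have a2 := hN2 N (by omega)
  have a3 := hN3 N (by omega)
  rw [Real.dist_eq, abs_lt] at a1 a2
  have b1 : avg (S N) (fun t => z t ∈ G) ≤ avg (S N) fun t => z t ∈ B :=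
    avg_mono _ fun t ht => (Finset.mem_filter.1 ht).2
  -- The share of `B` outside `F` is at most the share of the complement of `F`, which is eventually
  -- less than `ε / 2`.
  have b2 : avg (S N) (fun t => z t ∈ B) + avg (S N) (fun t => z t ∈ F) ≤
      avg (S N) (fun t => z t ∈ G) + 1 := by
    have c1 := avg_add_of_disjoint (S N) (p := fun t => z t ∈ G)
      (q := fun t => z t ∈ B ∧ z t ∉ F) fun t h1 h2 => h2.2 (Finset.mem_filter.1 h1).1
    have c2 := avg_add_of_disjoint (S N) (p := fun t => z t ∈ F)
      (q := fun t => z t ∈ B ∧ z t ∉ F) fun t h1 h2 => h2.2 h1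
    have c3 : avg (S N) (fun t => z t ∈ B) ≤
        avg (S N) fun t => z t ∈ G ∨ (z t ∈ B ∧ z t ∉ F) := avg_mono _ fun t ht => by
      by_cases hc : z t ∈ F
      · exact .inl (Finset.mem_filter.2 ⟨hc, ht⟩)
      · exact .inr ⟨ht, hc⟩
    have c4 := avg_le_one (S N) (p := fun t => z t ∈ F ∨ (z t ∈ B ∧ z t ∉ F))
    linarith
  rw [Real.dist_eq, abs_lt]
  constructor <;> linarith

theorem measurable_avg {Ω T : Type*} [MeasurableSpace Ω] (S : Finset T) {p : T → Ω → Prop}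
    (hp : ∀ t, MeasurableSet {ω | p t ω}) : Measurable fun ω => avg S fun t => p t ω :=
  (Finset.measurable_sum _ fun t _ => measurable_ind (hp t)).div_const _

/-- If averages of equally likely events converge almost surely, then the expectation of the limit
is their probability. -/
theorem integral_eq_of_tendsto_avg {Ω T : Type*} [MeasurableSpace Ω] {P : Measure Ω}
    [IsProbabilityMeasure P] {S : ℕ → Finset T} {p : T → Ω → Prop} {c : ℝ} {g : Ω → ℝ}
    (hS : ∀ᶠ N in atTop, (S N).Nonempty) (hp : ∀ t, MeasurableSet {ω | p t ω})
    (hc : ∀ᶠ N in atTop, ∀ t ∈ S N, P.real {ω | p t ω} = c)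
    (hg : ∀ᵐ ω ∂P, Tendsto (fun N => avg (S N) fun t => p t ω) atTop (𝓝 (g ω))) :
    ∫ ω, g ω ∂P = c := by
  have h1 : Tendsto (fun N => ∫ ω, avg (S N) (fun t => p t ω) ∂P) atTop (𝓝 (∫ ω, g ω ∂P)) := by
    refine tendsto_integral_of_dominated_convergence (fun _ => 1)
      (fun N => (measurable_avg _ hp).aestronglyMeasurable) (integrable_const _) (fun N => ?_) hg
    refine ae_of_all _ fun ω => ?_
    rw [Real.norm_of_nonneg (avg_nonneg _)]
    exact avg_le_one _
  refine tendsto_nhds_unique h1 (tendsto_const_nhds.congr' ?_)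
  filter_upwards [hS, hc] with N hN hcN
  unfold avg
  rw [integral_div, integral_finsetSum _ fun t _ => integrable_ind (hp t),
    Finset.sum_congr rfl fun t ht => (integral_ind (hp t)).trans (hcN t ht)]
  have : ((S N).card : ℝ) ≠ 0 := by exact_mod_cast hN.card_pos.ne'
  rw [Finset.sum_const, nsmul_eq_mul]
  field_simp

/-! ### Limits of proportions -/

theorem proportion_nonneg (p : ℕ → Prop) (n : ℕ) : 0 ≤ proportion p n := by
  rw [proportion_eq_avg]; exact avg_nonneg _

theorem proportion_le_one (p : ℕ → Prop) (n : ℕ) : proportion p n ≤ 1 := by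
  rw [proportion_eq_avg]; exact avg_le_one _

theorem relFreq_eq {p : ℕ → Prop} {L : ℝ} (h : Tendsto (proportion p) atTop (𝓝 L)) :
    relFreq p = L := h.limsup_eq

theorem proportion_eq_sum (p : ℕ → Prop) (n : ℕ) :
    proportion p n = (∑ i ∈ Finset.range n, ind (p i)) / n := by
  rw [proportion_eq_avg, avg, Finset.card_range]

theorem sum_range_eq_mul_proportion (p : ℕ → Prop) (n : ℕ) :
    ∑ i ∈ Finset.range n, ind (p i) = n * proportion p n := by
  rw [proportion_eq_sum]
  rcases eq_or_ne n 0 with rfl | h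
  · simp
  · have : (n : ℝ) ≠ 0 := by exact_mod_cast h
    field_simp

theorem tendsto_proportion_shift (p : ℕ → Prop) (c : ℕ) (L : ℝ) :
    Tendsto (proportion fun i => p (c + i)) atTop (𝓝 L) ↔
      Tendsto (proportion p) atTop (𝓝 L) := by
  rw [← tendsto_add_atTop_iff_nat (f := proportion p) c]
  have e : ∀ n, ∑ i ∈ Finset.range (n + c), ind (p i) =
      ∑ i ∈ Finset.range c, ind (p i) + ∑ i ∈ Finset.range n, ind (p (c + i)) := fun n => by
    rw [add_comm n c, Finset.sum_range_add]
  set K := ∑ i ∈ Finset.range c, ind (p i) with hK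
  have hd : Tendsto (fun n : ℕ => ((n + c : ℕ) : ℝ)) atTop atTop :=
    tendsto_natCast_atTop_atTop.comp (tendsto_add_atTop_nat c)
  have hn : Tendsto (fun n : ℕ => (n : ℝ)) atTop atTop := tendsto_natCast_atTop_atTop
  -- Dropping `c` indices changes the proportion by at most `(K + c) / n`, so both sequences have
  -- the same limits.
  have hdiff : Tendsto (fun n => proportion p (n + c) - proportion (fun i => p (c + i)) n)
      atTop (𝓝 0) := by
    have hz : Tendsto (fun n : ℕ => (K + c) / (n : ℝ)) atTop (𝓝 0) :=
      tendsto_const_nhds.div_atTop hn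
    refine squeeze_zero_norm' ?_ hz
    filter_upwards [eventually_gt_atTop 0] with n hn0
    have hn1 : (0 : ℝ) < n := by exact_mod_cast hn0
    have hK0 : 0 ≤ K := Finset.sum_nonneg fun _ _ => ind_nonneg _
    set q := proportion (fun i => p (c + i)) n
    have hq0 : 0 ≤ q := proportion_nonneg _ _
    have hq1 : q ≤ 1 := proportion_le_one _ _
    have hc0 : (0 : ℝ) ≤ c := Nat.cast_nonneg c
    have e2 : proportion p (n + c) - q = (K - c * q) / (n + c) := by
      rw [proportion_eq_sum, e n, sum_range_eq_mul_proportion (fun i => p (c + i)) n]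
      push_cast
      field_simp
      ring
    rw [e2, Real.norm_eq_abs, abs_div, abs_of_pos (by positivity : (0 : ℝ) < n + c)]
    have e3 : |K - c * q| ≤ K + c := by
      rw [abs_le]
      constructor <;> nlinarith [mul_nonneg hc0 hq0, mul_le_mul_of_nonneg_left hq1 hc0]
    exact div_le_div₀ (by positivity) e3 hn1 (by linarith)
  constructor
  · intro h
    simpa using hdiff.add h
  · intro h
    simpa using h.sub hdiff

theorem tendsto_proportion_congr {p q : ℕ → Prop} {c : ℕ} (h : ∀ i, c ≤ i → (p i ↔ q i)) {L : ℝ}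
    (hp : Tendsto (proportion p) atTop (𝓝 L)) : Tendsto (proportion q) atTop (𝓝 L) := by
  rw [← tendsto_proportion_shift _ c] at hp ⊢
  simpa only [h _ (Nat.le_add_right c _)] using hp

/-- A block sum is a difference of two initial sums, and `(j + 1) * L - j * L = L`. Disjoint blocks
serve to choose distinct edge labels independently of each other. -/
theorem tendsto_avg_block {p : ℕ → Prop} {L : ℝ} (h : Tendsto (proportion p) atTop (𝓝 L))
    (j : ℕ) : Tendsto (fun N => avg (Finset.Ico (j * N) ((j + 1) * N)) p) atTop (𝓝 L) := by
  have hm : ∀ k : ℕ, Tendsto (fun N : ℕ => (k : ℝ) * proportion p (k * N)) atTop (𝓝 (k * L)) := by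
    intro k
    rcases Nat.eq_zero_or_pos k with rfl | hk
    · simp
    · exact (h.comp (tendsto_id.const_mul_atTop' hk)).const_mul _
  have h2 := (hm (j + 1)).sub (hm j)
  have : ((j + 1 : ℕ) : ℝ) * L - j * L = L := by push_cast; ring
  rw [this] at h2
  refine h2.congr' ?_
  filter_upwards [eventually_gt_atTop 0] with N hN
  have hN' : (N : ℝ) ≠ 0 := by exact_mod_cast hN.ne'
  have hle : j * N ≤ (j + 1) * N := Nat.mul_le_mul_right N (Nat.le_succ j)
  have hcard : (j + 1) * N - j * N = N := by rw [Nat.succ_mul]; omega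
  rw [avg, Nat.card_Ico, hcard, Finset.sum_Ico_eq_sub _ hle, sum_range_eq_mul_proportion,
    sum_range_eq_mul_proportion]
  push_cast
  field_simp

/-! ### A law of large numbers for pairwise exchangeable events -/

theorem ae_summable_of_summable_integral {Ω : Type*} [MeasurableSpace Ω] {P : Measure Ω}
    {u : ℕ → Ω → ℝ} (hu : ∀ k ω, 0 ≤ u k ω)
    (hi : ∀ k, Integrable (u k) P) (hs : Summable fun k => ∫ ω, u k ω ∂P) :
    ∀ᵐ ω ∂P, Summable fun k => u k ω := by
  have h1 : ∫⁻ ω, ∑' k, ENNReal.ofReal (u k ω) ∂P ≠ ∞ := by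
    rw [lintegral_tsum fun k => (hi k).aestronglyMeasurable.aemeasurable.ennreal_ofReal]
    simp only [← ofReal_integral_eq_lintegral_ofReal (hi _) (ae_of_all _ (hu _))]
    exact hs.tsum_ofReal_ne_top
  filter_upwards [ae_lt_top' (AEMeasurable.tsum fun k =>
    (hi k).aestronglyMeasurable.aemeasurable.ennreal_ofReal) h1] with ω hω
  have := ENNReal.summable_toReal hω.ne
  simpa only [ENNReal.toReal_ofReal (hu _ ω)] using this

/-- Counts increase with `n` and consecutive fourth powers have ratio tending to 1, so convergence
along fourth powers interpolates to all `n`. -/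
theorem tendsto_proportion_of_pow_four {q : ℕ → Prop} {L : ℝ}
    (h : Tendsto (fun k : ℕ => proportion q ((k + 1) ^ 4)) atTop (𝓝 L)) :
    Tendsto (proportion q) atTop (𝓝 L) := by
  have e : proportion q = fun n : ℕ => (∑ i ∈ Finset.range n, ind (q i)) / n :=
    funext fun n => proportion_eq_sum q n
  rw [e]
  refine tendsto_div_of_monotone_of_exists_subseq_tendsto_div _ _ ?_ ?_
  · intro n m hnm
    exact Finset.sum_le_sum_of_subset_of_nonneg (Finset.range_mono hnm)
      fun _ _ _ => ind_nonneg _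
  · intro r hr
    refine ⟨fun k => (k + 1) ^ 4, ?_, ?_, ?_⟩
    · have h1 : Tendsto (fun k : ℕ => (1 + 1 / ((k : ℝ) + 1)) ^ 4) atTop (𝓝 1) := by
        simpa using (tendsto_one_div_add_atTop_nhds_zero_nat.const_add (1 : ℝ)).pow 4
      filter_upwards [h1.eventually_lt_const hr] with k hk
      have hk0 : (0 : ℝ) < (k : ℝ) + 1 := by positivity
      have : ((k : ℝ) + 1 + 1) ^ 4 = (1 + 1 / ((k : ℝ) + 1)) ^ 4 * ((k : ℝ) + 1) ^ 4 := by
        rw [← mul_pow]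
        congr 1
        field_simp
      push_cast
      rw [this]
      exact mul_le_mul_of_nonneg_right hk.le (by positivity)
    · exact (tendsto_pow_atTop (by norm_num)).comp (tendsto_add_atTop_nat 1)
    · rw [e] at h
      exact h

section PairwiseExchangeable

variable {Ω : Type*} [MeasurableSpace Ω] {P : Measure Ω} [IsProbabilityMeasure P]
  {p : ℕ → Ω → Prop} {a b : ℝ}

/-- Of the `n * m` pairs of indices, the `n` diagonal ones contribute `a` and all others `b`. -/
theorem integral_proportion_mul (hm : ∀ i, MeasurableSet {ω | p i ω})
    (ha : ∀ i, P.real {ω | p i ω} = a) (hb : ∀ i j, i ≠ j → P.real {ω | p i ω ∧ p j ω} = b)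
    {n m : ℕ} (hn : 0 < n) (hnm : n ≤ m) :
    ∫ ω, proportion (fun i => p i ω) n * proportion (fun i => p i ω) m ∂P = b + (a - b) / m := by
  have hn' : (n : ℝ) ≠ 0 := by exact_mod_cast hn.ne'
  have hm' : (m : ℝ) ≠ 0 := by exact_mod_cast (hn.trans_le hnm).ne'
  have e1 : ∀ ω, proportion (fun i => p i ω) n * proportion (fun i => p i ω) m =
      (∑ i ∈ Finset.range n, ∑ j ∈ Finset.range m, ind (p i ω ∧ p j ω)) / (n * m) := fun ω => by
    rw [proportion_eq_sum, proportion_eq_sum, div_mul_div_comm, Finset.sum_mul_sum]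
    simp only [ind_and]
  have hm2 : ∀ i j, MeasurableSet {ω | p i ω ∧ p j ω} := fun i j => (hm i).inter (hm j)
  simp only [e1]
  rw [integral_div, integral_finsetSum _ fun i _ =>
    integrable_finsetSum _ fun j _ => integrable_ind (hm2 i j)]
  have e2 : ∀ i ∈ Finset.range n,
      ∫ ω, ∑ j ∈ Finset.range m, ind (p i ω ∧ p j ω) ∂P = (a - b) + m * b := by
    intro i hi
    rw [integral_finsetSum _ fun j _ => integrable_ind (hm2 i j)]
    have e3 : ∀ j ∈ Finset.range m, ∫ ω, ind (p i ω ∧ p j ω) ∂P =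
        (if i = j then a - b else 0) + b := by
      intro j _
      rw [integral_ind (hm2 i j)]
      split_ifs with h
      · subst h
        simp only [and_self, ha]
        ring
      · rw [hb i j h, zero_add]
    rw [Finset.sum_congr rfl e3, Finset.sum_add_distrib, Finset.sum_ite_eq,
      if_pos (Finset.mem_range.2 ((Finset.mem_range.1 hi).trans_le hnm))]
    simp
  rw [Finset.sum_congr rfl e2, Finset.sum_const, Finset.card_range, nsmul_eq_mul]
  field_simp
  ring

theorem measurable_proportion (hm : ∀ i, MeasurableSet {ω | p i ω}) (n : ℕ) :
    Measurable fun ω => proportion (fun i => p i ω) n := by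
  simp only [proportion_eq_avg]
  exact measurable_avg _ hm

/-- Expanding the square, `b` cancels and `(a - b) * (1 / n - 1 / m)` remains. -/
theorem integral_proportion_sub_sq_le (hm : ∀ i, MeasurableSet {ω | p i ω})
    (ha : ∀ i, P.real {ω | p i ω} = a) (hb : ∀ i j, i ≠ j → P.real {ω | p i ω ∧ p j ω} = b)
    {n m : ℕ} (hn : 0 < n) (hnm : n ≤ m) :
    ∫ ω, (proportion (fun i => p i ω) n - proportion (fun i => p i ω) m) ^ 2 ∂P ≤ 1 / n := by
  have hint : ∀ k l, Integrable (fun ω => proportion (fun i => p i ω) k *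
      proportion (fun i => p i ω) l) P := fun k l => by
    refine Integrable.of_bound ((measurable_proportion hm k).mul
      (measurable_proportion hm l)).aestronglyMeasurable 1 (ae_of_all _ fun ω => ?_)
    rw [Real.norm_of_nonneg (mul_nonneg (proportion_nonneg _ _) (proportion_nonneg _ _))]
    exact mul_le_one₀ (proportion_le_one _ _) (proportion_nonneg _ _) (proportion_le_one _ _)
  have e : ∀ ω, (proportion (fun i => p i ω) n - proportion (fun i => p i ω) m) ^ 2 =
      proportion (fun i => p i ω) n * proportion (fun i => p i ω) n -
      2 * (proportion (fun i => p i ω) n * proportion (fun i => p i ω) m) +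
      proportion (fun i => p i ω) m * proportion (fun i => p i ω) m := fun ω => by ring
  simp only [e]
  have hsub : Integrable (fun ω => proportion (fun i => p i ω) n * proportion (fun i => p i ω) n -
      2 * (proportion (fun i => p i ω) n * proportion (fun i => p i ω) m)) P :=
    (hint n n).sub ((hint n m).const_mul 2)
  rw [integral_add hsub (hint m m),
    integral_sub (hint n n) ((hint n m).const_mul 2), integral_const_mul,
    integral_proportion_mul hm ha hb hn le_rfl, integral_proportion_mul hm ha hb hn hnm,
    integral_proportion_mul hm ha hb (hn.trans_le hnm) le_rfl]
  have hn' : (0 : ℝ) < n := by exact_mod_cast hn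
  have hm' : (0 : ℝ) < m := by exact_mod_cast hn.trans_le hnm
  have ha1 : a ≤ 1 := ha 0 ▸ measureReal_le_one
  have hab : b ≤ a := by
    rw [← ha 0, ← hb 0 1 (by norm_num)]
    exact measureReal_mono fun ω h => h.1
  have hb0 : 0 ≤ b := hb 0 1 (by norm_num) ▸ measureReal_nonneg
  have h1 : (a - b) / n ≤ 1 / n := div_le_div_of_nonneg_right (by linarith) hn'.le
  have h2 : 0 ≤ (a - b) / m := div_nonneg (by linarith) hm'.le
  linarith

/-- The proportion of pairwise exchangeable events that occur converges almost surely. -/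
theorem ae_exists_tendsto_proportion (hm : ∀ i, MeasurableSet {ω | p i ω})
    (ha : ∀ i, P.real {ω | p i ω} = a) (hb : ∀ i j, i ≠ j → P.real {ω | p i ω ∧ p j ω} = b) :
    ∀ᵐ ω ∂P, ∃ L, Tendsto (proportion fun i => p i ω) atTop (𝓝 L) := by
  -- Along fourth powers the mean squared increments are at most `1 / (k + 1) ^ 4`, still summable
  -- after multiplication by `(k + 1) ^ 2`.
  set A : ℕ → Ω → ℝ := fun k ω => proportion (fun i => p i ω) ((k + 1) ^ 4) with hA
  have hAm : ∀ k, Measurable (A k) := fun k => measurable_proportion hm _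
  have hs2 : Summable fun k : ℕ => 1 / ((k : ℝ) + 1) ^ 2 := by
    have := (summable_nat_add_iff 1).2 (Real.summable_one_div_nat_pow.2 one_lt_two)
    simpa using this
  have hae := ae_summable_of_summable_integral (P := P)
    (u := fun k ω => ((k : ℝ) + 1) ^ 2 * (A k ω - A (k + 1) ω) ^ 2)
    (fun k ω => by positivity) (fun k => ?_) ?_
  · filter_upwards [hae] with ω hω
    have hd : Summable fun k => dist (A k ω) (A (k + 1) ω) := by
      refine Summable.of_nonneg_of_le (fun _ => dist_nonneg) (fun k => ?_) (hs2.add hω)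
      rw [Real.dist_eq]
      set d := |A k ω - A (k + 1) ω| with hdd
      rw [← sq_abs (A k ω - A (k + 1) ω), ← hdd]
      have hk : (0 : ℝ) < (k : ℝ) + 1 := by positivity
      have h1 : ((k : ℝ) + 1) ^ 2 * (1 / ((k : ℝ) + 1) ^ 2) = 1 := by field_simp
      have h2 : 1 / ((k : ℝ) + 1) ^ 2 = (1 / ((k : ℝ) + 1)) ^ 2 := by rw [div_pow, one_pow]
      have h3 : (1 / ((k : ℝ) + 1)) * (((k : ℝ) + 1) * d) = d := by field_simp
      have h4 : 0 ≤ d := abs_nonneg _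
      -- The inequality `x * y ≤ x ^ 2 + y ^ 2` with `x = 1 / (k + 1)` and `y = (k + 1) * d` bounds
      -- the increment `d` by summable terms, so the subsequence is Cauchy.
      nlinarith [sq_nonneg (1 / ((k : ℝ) + 1) - ((k : ℝ) + 1) * d)]
    obtain ⟨L, hL⟩ := cauchySeq_tendsto_of_complete (cauchySeq_of_summable_dist hd)
    exact ⟨L, tendsto_proportion_of_pow_four hL⟩
  · refine Integrable.const_mul (Integrable.of_bound
      (((hAm k).sub (hAm (k + 1))).pow_const 2).aestronglyMeasurable 1
      (ae_of_all _ fun ω => ?_)) _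
    have h0 := proportion_nonneg (fun i => p i ω) ((k + 1) ^ 4)
    have h1 := proportion_le_one (fun i => p i ω) ((k + 1) ^ 4)
    have h2 := proportion_nonneg (fun i => p i ω) ((k + 1 + 1) ^ 4)
    have h3 := proportion_le_one (fun i => p i ω) ((k + 1 + 1) ^ 4)
    rw [Real.norm_of_nonneg (sq_nonneg _), sq_le_one_iff_abs_le_one, abs_le, Pi.sub_apply]
    constructor <;> simp only [hA] <;> linarith
  · refine Summable.of_nonneg_of_le (fun k => integral_nonneg fun ω => by positivity)
      (fun k => ?_) hs2
    rw [integral_const_mul]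
    have h := integral_proportion_sub_sq_le hm ha hb (n := (k + 1) ^ 4) (m := (k + 1 + 1) ^ 4)
      (by positivity) (Nat.pow_le_pow_left (Nat.le_succ _) 4)
    refine (mul_le_mul_of_nonneg_left h (by positivity)).trans (le_of_eq ?_)
    push_cast
    field_simp

end PairwiseExchangeable

/-! ### Relative frequencies of the edges -/

theorem measurable_relFreq {Ω : Type*} [MeasurableSpace Ω] {p : ℕ → Ω → Prop}
    (hm : ∀ i, MeasurableSet {ω | p i ω}) : Measurable fun ω => relFreq fun i => p i ω :=
  Measurable.limsup fun n => measurable_proportion hm n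

theorem measurableSet_canon_eq (i j : ℕ) :
    MeasurableSet {E : Network ℕ | E.canon i = E.canon j} :=
  measurableSet_eq_fun (measurable_canon_apply i) (measurable_canon_apply j)

theorem measurableSet_canon_mem (i : ℕ) (B : Set (List ℕ)) :
    MeasurableSet {E : Network ℕ | E.canon i ∈ B} :=
  measurable_canon_apply i (MeasurableSet.of_discrete (s := B))

theorem measurable_edgeFreq_apply (s : List ℕ) :
    Measurable fun E : Network ℕ => E.edgeFreq s :=
  measurable_relFreq fun i => measurableSet_canon_mem i {s}

/-- A network in which every edge has a positive relative frequency, these being limits of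
proportions and adding up to one. -/
structure Network.Regular (E : Network ℕ) : Prop where
  tendsto : ∀ s, Tendsto (proportion fun i => E.canon i = s) atTop (𝓝 (E.edgeFreq s))
  hasSum : HasSum E.edgeFreq 1
  pos : ∀ i, 0 < E.edgeFreq (E.canon i)

section ExchLaw

variable {ν : Measure (Network ℕ)} [IsProbabilityMeasure ν]

/-- Equality with edge `m` does not depend on vertex labels, unlike equality with a fixed list.
Using only the indices after `m` keeps them distinct from `m`, and hence pairwise exchangeable
relative to it. -/
theorem ExchLaw.ae_exists_tendsto (hν : ExchLaw ν) (m : ℕ) :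
    ∀ᵐ E ∂ν, ∃ L, Tendsto (proportion fun i => E.canon i = E.canon m) atTop (𝓝 L) := by
  have h := ae_exists_tendsto_proportion (P := ν)
    (p := fun i E => E.canon (m + 1 + i) = E.canon m)
    (a := ν.real {E | E.canon (m + 1) = E.canon m})
    (b := ν.real {E | E.canon (m + 1) = E.canon m ∧ E.canon (m + 2) = E.canon m})
    (fun i => measurableSet_canon_eq _ _) (fun i => ?_) (fun i j hij => ?_)
  · filter_upwards [h] with E ⟨L, hL⟩
    exact ⟨L, (tendsto_proportion_shift (fun i => E.canon i = E.canon m) (m + 1) L).1 hL⟩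
  · have := hν.measure_injective (n := 2) (Q := fun I => I 0 = I 1)
      (fun I J h => h.eq_iff 0 1) (τ := ![m + 1 + i, m]) (τ' := ![m + 1, m])
      (by intro x y; fin_cases x <;> fin_cases y <;> simp <;> omega)
      (by intro x y; fin_cases x <;> fin_cases y <;> simp)
    exact congrArg ENNReal.toReal this
  · have := hν.measure_injective (n := 3) (Q := fun I => I 0 = I 2 ∧ I 1 = I 2)
      (fun I J h => and_congr (h.eq_iff 0 2) (h.eq_iff 1 2))
      (τ := ![m + 1 + i, m + 1 + j, m]) (τ' := ![m + 1, m + 2, m])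
      (by intro x y; fin_cases x <;> fin_cases y <;> simp <;> omega)
      (by intro x y; fin_cases x <;> fin_cases y <;> simp)
    exact congrArg ENNReal.toReal this

theorem ExchLaw.ae_tendsto_edgeFreq (hν : ExchLaw ν) : ∀ᵐ E ∂ν,
    ∀ s, Tendsto (proportion fun i => E.canon i = s) atTop (𝓝 (E.edgeFreq s)) := by
  filter_upwards [ae_all_iff.2 hν.ae_exists_tendsto] with E hE s
  obtain ⟨L, hL⟩ : ∃ L, Tendsto (proportion fun i => E.canon i = s) atTop (𝓝 L) := by
    by_cases h : ∃ m, E.canon m = s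
    · obtain ⟨m, rfl⟩ := h
      exact hE m
    · refine ⟨0, tendsto_const_nhds.congr fun n => ?_⟩
      rw [proportion_eq_sum, Finset.sum_eq_zero fun i _ => ind_of_false fun hi => h ⟨i, hi⟩,
        zero_div]
  have : E.edgeFreq s = L := relFreq_eq hL
  rwa [this]

theorem sum_edgeFreq_eq_lim {E : Network ℕ}
    (hE : ∀ s, Tendsto (proportion fun i => E.canon i = s) atTop (𝓝 (E.edgeFreq s)))
    (F : Finset (List ℕ)) :
    Tendsto (proportion fun i => E.canon i ∈ F) atTop (𝓝 (∑ s ∈ F, E.edgeFreq s)) := by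
  have : proportion (fun i => E.canon i ∈ F) =
      fun n => ∑ s ∈ F, proportion (fun i => E.canon i = s) n := by
    funext n
    simp only [proportion_eq_avg, avg_mem_finset]
  rw [this]
  exact tendsto_finsetSum _ fun s _ => hE s

/-- The probability that an edge is among the first `K` other ones tends to one. -/
theorem ExchLaw.tendsto_measure_mem_prefix (hν : ExchLaw ν) (hb : ∀ᵐ E ∂ν, E.BlipFree) :
    Tendsto (fun K : ℕ => ν {E | ∃ j < K, E.canon j = E.canon K}) atTop (𝓝 1) := by
  -- Moving edge `K` to position 0 and its predecessors to `1, …, K` makes the events increase with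
  -- `K`; their union contains the blip-free networks.
  have e : ∀ K : ℕ, ν {E | ∃ j < K, E.canon j = E.canon K} =
      ν {E | ∃ j < K, E.canon (j + 1) = E.canon 0} := fun K => by
    have := hν.measure_injective (n := K + 1)
      (Q := fun I => ∃ j : Fin K, I j.castSucc = I (Fin.last K))
      (fun I J h => exists_congr fun j => h.eq_iff _ _)
      (τ := fun i => i) (τ' := Fin.snoc (α := fun _ => ℕ) (fun j : Fin K => (j : ℕ) + 1) 0)
      Fin.val_injective ?_
    · simpa [Fin.exists_iff] using this
    · rw [Fin.snoc_injective_iff]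
      refine ⟨fun i j h => Fin.ext (by simpa using h), ?_⟩
      rintro ⟨j, hj⟩
      simp at hj
  simp only [e]
  have hU : ν (⋃ K : ℕ, {E | ∃ j < K, E.canon (j + 1) = E.canon 0}) = 1 := by
    refine (prob_compl_eq_zero_iff₀ (MeasurableSet.iUnion fun K => ?_).nullMeasurableSet).1 ?_
    · have : {E : Network ℕ | ∃ j < K, E.canon (j + 1) = E.canon 0} =
          ⋃ j ∈ Finset.range K, {E | E.canon (j + 1) = E.canon 0} := by ext; simp
      rw [this]
      exact Finset.measurableSet_biUnion _ fun j _ => measurableSet_canon_eq _ _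
    · refine measure_mono_null (t := {E | ¬ E.BlipFree}) (fun E hE hbf => hE ?_) (ae_iff.1 hb)
      obtain ⟨j, hj, h⟩ := hbf 0
      obtain ⟨i, rfl⟩ := Nat.exists_eq_succ_of_ne_zero hj
      exact Set.mem_iUnion.2 ⟨i + 1, i, Nat.lt_succ_self i, h⟩
  rw [← hU]
  refine tendsto_measure_iUnion_atTop fun K L hKL E => ?_
  rintro ⟨j, hj, h⟩
  exact ⟨j, hj.trans_le hKL, h⟩

/-- Edge `K` may be replaced by any later edge. Averaging over these turns the probability into the
expected total frequency of the first `K` edges, counted without repetition. -/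
theorem ExchLaw.measure_mem_prefix_le (hν : ExchLaw ν) (K : ℕ) :
    ν {E | ∃ j < K, E.canon j = E.canon K} ≤
      ∫⁻ E, ∑' s, ENNReal.ofReal (E.edgeFreq s) ∂ν := by
  classical
  have hm : ∀ i, MeasurableSet {E : Network ℕ | ∃ j < K, E.canon j = E.canon (K + i)} := fun i => by
    have : {E : Network ℕ | ∃ j < K, E.canon j = E.canon (K + i)} =
        ⋃ j ∈ Finset.range K, {E | E.canon j = E.canon (K + i)} := by ext; simp
    rw [this]
    exact Finset.measurableSet_biUnion _ fun j _ => measurableSet_canon_eq _ _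
  have hlim : ∀ᵐ E ∂ν, Tendsto
      (fun N => avg (Finset.range N) fun i => ∃ j < K, E.canon j = E.canon (K + i)) atTop
      (𝓝 (∑ s ∈ (Finset.range K).image E.canon, E.edgeFreq s)) := by
    filter_upwards [hν.ae_tendsto_edgeFreq] with E hE
    have h := sum_edgeFreq_eq_lim hE ((Finset.range K).image E.canon)
    rw [← tendsto_proportion_shift _ K] at h
    refine h.congr fun N => ?_
    rw [proportion_eq_avg]
    simp only [Finset.mem_image, Finset.mem_range]
  have hint := integral_eq_of_tendsto_avg (P := ν) (S := Finset.range)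
    (c := ν.real {E | ∃ j < K, E.canon j = E.canon K})
    ((eventually_gt_atTop 0).mono fun N hN => Finset.nonempty_range_iff.2 hN.ne') hm
    (Eventually.of_forall fun N i _ => ?_) hlim
  · have hmeas := aestronglyMeasurable_of_tendsto_ae atTop
      (fun N => (measurable_avg (Finset.range N) hm).aestronglyMeasurable) hlim
    have hnn : ∀ᵐ E ∂ν, 0 ≤ ∑ s ∈ (Finset.range K).image E.canon, E.edgeFreq s := by
      filter_upwards [hlim] with E hE using ge_of_tendsto' hE fun N => avg_nonneg _
    rw [integral_eq_lintegral_of_nonneg_ae hnn hmeas] at hint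
    have hfin : ∫⁻ E, ENNReal.ofReal (∑ s ∈ (Finset.range K).image E.canon, E.edgeFreq s) ∂ν ≠ ∞ := by
      refine (lintegral_mono_ae (g := fun _ => 1) ?_).trans_lt (by simp) |>.ne
      filter_upwards [hlim] with E hE
      exact ENNReal.ofReal_le_one.2 (le_of_tendsto' hE fun N => avg_le_one _)
    rw [measureReal_def, ENNReal.toReal_eq_toReal_iff' hfin (measure_ne_top _ _)] at hint
    rw [← hint]
    refine lintegral_mono_ae ?_
    filter_upwards [hν.ae_tendsto_edgeFreq] with E hE
    rw [ENNReal.ofReal_sum_of_nonneg fun s _ => ge_of_tendsto' (hE s) fun N => proportion_nonneg _ _]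
    exact ENNReal.sum_le_tsum _
  · have := hν.measure_injective (n := K + 1)
      (Q := fun I => ∃ j : Fin K, I j.castSucc = I (Fin.last K))
      (fun I J h => exists_congr fun j => h.eq_iff _ _)
      (τ := Fin.snoc (α := fun _ => ℕ) (fun j : Fin K => (j : ℕ)) (K + i)) (τ' := fun i => i)
      ?_ Fin.val_injective
    · refine congrArg ENNReal.toReal ?_
      simpa [Fin.exists_iff] using this
    · rw [Fin.snoc_injective_iff]
      refine ⟨Fin.val_injective, ?_⟩
      rintro ⟨j, hj⟩
      have := j.2
      simp at hj
      omega

/-- The total frequency is at most 1 almost surely and has mean at least 1, so it equals 1 almost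
surely. -/
theorem ExchLaw.ae_hasSum_edgeFreq (hν : ExchLaw ν) (hb : ∀ᵐ E ∂ν, E.BlipFree) :
    ∀ᵐ E ∂ν, HasSum E.edgeFreq 1 := by
  have hnn : ∀ᵐ E ∂ν, ∀ s, 0 ≤ E.edgeFreq s := by
    filter_upwards [hν.ae_tendsto_edgeFreq] with E hE s
    exact ge_of_tendsto' (hE s) fun N => proportion_nonneg _ _
  have hle : ∀ᵐ E ∂ν, ∑' s, ENNReal.ofReal (E.edgeFreq s) ≤ 1 := by
    filter_upwards [hν.ae_tendsto_edgeFreq, hnn] with E hE h0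
    rw [ENNReal.tsum_eq_iSup_sum]
    refine iSup_le fun F => ?_
    rw [← ENNReal.ofReal_sum_of_nonneg fun s _ => h0 s]
    exact ENNReal.ofReal_le_one.2
      (le_of_tendsto' (sum_edgeFreq_eq_lim hE F) fun N => proportion_le_one _ _)
  have hge : 1 ≤ ∫⁻ E, ∑' s, ENNReal.ofReal (E.edgeFreq s) ∂ν :=
    le_of_tendsto' (hν.tendsto_measure_mem_prefix hb) hν.measure_mem_prefix_le
  have hm : Measurable fun E : Network ℕ => ∑' s, ENNReal.ofReal (E.edgeFreq s) :=
    Measurable.tsum fun s => (measurable_edgeFreq_apply s).ennreal_ofReal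
  have heq := ae_eq_of_ae_le_of_lintegral_le hle
    ((lintegral_mono_ae hle).trans_lt (by simp)).ne aemeasurable_const (by simpa using hge)
  filter_upwards [heq, hnn] with E hE h0
  have hs : Summable fun s => (ENNReal.ofReal (E.edgeFreq s)).toReal :=
    ENNReal.summable_toReal (by rw [hE]; simp)
  simp only [ENNReal.toReal_ofReal (h0 _)] at hs
  have := hs.hasSum
  rwa [← ENNReal.toReal_ofReal (tsum_nonneg h0), ENNReal.ofReal_tsum_of_nonneg h0 hs, hE,
    ENNReal.toReal_one] at this

/-- The proportion of indices whose edge has frequency zero tends to the total mass of the lists of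
frequency zero, which is 0. By exchangeability the probability that edge `i` is of this kind does
not depend on `i`, so it is 0. -/
theorem ExchLaw.ae_edgeFreq_pos (hν : ExchLaw ν) (hb : ∀ᵐ E ∂ν, E.BlipFree) :
    ∀ᵐ E ∂ν, ∀ i, 0 < E.edgeFreq (E.canon i) := by
  have hm : ∀ i, MeasurableSet {E : Network ℕ | E.edgeFreq (E.canon i) = 0} := fun i =>
    measurable_relFreq (fun j => measurableSet_canon_eq j i) (measurableSet_singleton 0)
  have hc : ∀ i, ν {E | E.edgeFreq (E.canon i) = 0} = ν {E | E.edgeFreq (E.canon 0) = 0} := by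
    intro i
    refine Eq.trans ?_ (hν.measure_perm (Q := fun I => relFreq (fun j => I j = I 0) = 0)
      (fun I J h => by simp only [h.eq_iff]) (hm 0) (Equiv.swap 0 i))
    refine measure_congr ?_
    filter_upwards [hν.ae_tendsto_edgeFreq] with E hE
    -- The transposition moves only two indices, which does not affect limiting proportions.
    have h : Tendsto (proportion fun j => E.canon (Equiv.swap 0 i j) = E.canon i) atTop
        (𝓝 (E.edgeFreq (E.canon i))) := by
      refine tendsto_proportion_congr (c := i + 1) (fun j hj => ?_) (hE (E.canon i))
      rw [Equiv.swap_apply_of_ne_of_ne (by omega) (by omega)]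
    apply propext
    change E.edgeFreq (E.canon i) = 0 ↔
      relFreq (fun j => E.canon (Equiv.swap 0 i j) = E.canon (Equiv.swap 0 i 0)) = 0
    rw [Equiv.swap_apply_left, relFreq_eq h]
  have hzero := integral_eq_of_tendsto_avg (P := ν) (S := Finset.range)
    (p := fun i E => E.edgeFreq (E.canon i) = 0) (g := fun _ => 0)
    (c := ν.real {E | E.edgeFreq (E.canon 0) = 0})
    ((eventually_gt_atTop 0).mono fun N hN => Finset.nonempty_range_iff.2 hN.ne') hm
    (Eventually.of_forall fun N i _ => congrArg ENNReal.toReal (hc i)) ?_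
  · rw [integral_zero, eq_comm, measureReal_eq_zero_iff] at hzero
    refine ae_all_iff.2 fun i => ?_
    have hi : ∀ᵐ E ∂ν, E.edgeFreq (E.canon i) ≠ 0 := by
      rw [ae_iff]
      simpa [hc i] using hzero
    filter_upwards [hi, hν.ae_tendsto_edgeFreq] with E h1 hE
    exact lt_of_le_of_ne (ge_of_tendsto' (hE _) fun N => proportion_nonneg _ _) h1.symm
  · filter_upwards [hν.ae_tendsto_edgeFreq, hν.ae_hasSum_edgeFreq hb] with E hE hs
    have := tendsto_avg_mem (S := Finset.range) (z := E.canon)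
      ((eventually_gt_atTop 0).mono fun N hN => Finset.nonempty_range_iff.2 hN.ne') hs
      (fun s => (hE s).congr fun N => proportion_eq_avg _ N) {s | E.edgeFreq s = 0}
    have h0 : ∑' s, Set.indicator {s | E.edgeFreq s = 0} E.edgeFreq s = 0 := by
      refine (tsum_congr fun s => ?_).trans tsum_zero
      by_cases h : E.edgeFreq s = 0
      · rw [Set.indicator_of_mem (show s ∈ {s | E.edgeFreq s = 0} from h), h]
      · exact Set.indicator_of_notMem (show s ∉ {s | E.edgeFreq s = 0} from h) _
    rwa [h0] at this

theorem ExchLaw.ae_regular (hν : ExchLaw ν) (hb : ∀ᵐ E ∂ν, E.BlipFree) :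
    ∀ᵐ E ∂ν, E.Regular := by
  filter_upwards [hν.ae_tendsto_edgeFreq, hν.ae_hasSum_edgeFreq hb, hν.ae_edgeFreq_pos hb]
    with E h1 h2 h3 using ⟨h1, h2, h3⟩

end ExchLaw

/-! ### Frequencies of sets of edges and of vertices in a regular network. -/

theorem Network.Regular.tendsto_mem {E : Network ℕ} (hE : E.Regular) (B : Set (List ℕ)) :
    Tendsto (proportion fun i => E.canon i ∈ B) atTop (𝓝 (∑' s, B.indicator E.edgeFreq s)) := by
  have := tendsto_avg_mem (S := Finset.range) (z := E.canon)
    ((eventually_gt_atTop 0).mono fun N hN => Finset.nonempty_range_iff.2 hN.ne') hE.hasSum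
    (fun s => (hE.tendsto s).congr fun N => proportion_eq_avg _ N) B
  simpa only [← proportion_eq_avg] using this

theorem Network.Regular.edgeFreq_nonneg {E : Network ℕ} (hE : E.Regular) (s : List ℕ) :
    0 ≤ E.edgeFreq s :=
  ge_of_tendsto' (hE.tendsto s) fun _ => proportion_nonneg _ _

theorem Network.Regular.arrivalFreq_eq {E : Network ℕ} (hE : E.Regular) (k : ℕ) :
    E.arrivalFreq k = ∑' s, Set.indicator {s : List ℕ | k ∈ s} E.edgeFreq s :=
  relFreq_eq (hE.tendsto_mem {s | k ∈ s})

theorem Network.Regular.tendsto_arrivalFreq {E : Network ℕ} (hE : E.Regular) (k : ℕ) :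
    Tendsto (proportion fun i => k ∈ E.canon i) atTop (𝓝 (E.arrivalFreq k)) := by
  rw [hE.arrivalFreq_eq]
  exact hE.tendsto_mem {s | k ∈ s}

/-! ### Independent edges with a given distribution -/

/-- A point of the simplex as a probability mass function. -/
noncomputable def Simplex.pmf (f : Simplex) : PMF (List ℕ) :=
  ⟨fun s => (f.1 s : ℝ≥0∞), by
    have := ENNReal.hasSum_coe.2 f.2
    rwa [ENNReal.coe_one] at this⟩

/-- The law of a single edge. -/
noncomputable def Simplex.edgeLaw (f : Simplex) : Measure (List ℕ) := f.pmf.toMeasure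

instance (f : Simplex) : IsProbabilityMeasure f.edgeLaw :=
  inferInstanceAs (IsProbabilityMeasure f.pmf.toMeasure)

theorem Simplex.edgeLaw_apply (f : Simplex) (B : Set (List ℕ)) :
    f.edgeLaw B = ∑' s, B.indicator (fun s => (f.1 s : ℝ≥0∞)) s :=
  f.pmf.toMeasure_apply .of_discrete

theorem Simplex.edgeLaw_singleton (f : Simplex) (s : List ℕ) :
    f.edgeLaw {s} = (f.1 s : ℝ≥0∞) :=
  f.pmf.toMeasure_apply_singleton _ .of_discrete

theorem Simplex.edgeLaw_eq_coe_tsum (f : Simplex) (p : List ℕ → Prop) [DecidablePred p] :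
    f.edgeLaw {s | p s} = ((∑' s, if p s then f.1 s else 0 : ℝ≥0) : ℝ≥0∞) := by
  have hs : Summable fun s => if p s then f.1 s else 0 :=
    NNReal.summable_of_le (fun s => by split_ifs <;> simp) f.2.summable
  rw [ENNReal.coe_tsum hs, f.edgeLaw_apply]
  refine tsum_congr fun s => ?_
  by_cases h : p s <;> simp [Set.indicator, h]

theorem coe_weight (f : Simplex) (v : ℕ) : (weight f v : ℝ≥0∞) = f.edgeLaw {s | v ∈ s} :=
  (f.edgeLaw_eq_coe_tsum fun s => v ∈ s).symm ▸ by unfold weight; congr!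

theorem coe_newMass (f : Simplex) (A : Finset ℕ) :
    (newMass f A : ℝ≥0∞) = f.edgeLaw {s | ∃ u ∈ s, u ∉ A} := by
  classical
  rw [f.edgeLaw_eq_coe_tsum fun s => ∃ u ∈ s, u ∉ A]
  unfold newMass
  congr!

theorem measurable_coe_simplex (s : List ℕ) : Measurable fun f : Simplex => (f.1 s : ℝ≥0∞) :=
  ((measurable_pi_apply s).comp measurable_subtype_coe).coe_nnreal_ennreal

theorem measurable_edgeLaw_apply (B : Set (List ℕ)) :
    Measurable fun f : Simplex => f.edgeLaw B := by
  simp only [Simplex.edgeLaw_apply]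
  refine Measurable.tsum fun s => ?_
  by_cases h : s ∈ B
  · simpa only [Set.indicator_of_mem h] using measurable_coe_simplex s
  · simpa only [Set.indicator_of_notMem h] using measurable_const

/-- The law of an i.i.d. sequence of edges. -/
noncomputable def Simplex.iidLaw (f : Simplex) : Measure (ℕ → List ℕ) :=
  Measure.infinitePi fun _ => f.edgeLaw

instance (f : Simplex) : IsProbabilityMeasure f.iidLaw :=
  inferInstanceAs (IsProbabilityMeasure (Measure.infinitePi fun _ => f.edgeLaw))

theorem measurable_iidLaw : Measurable Simplex.iidLaw := by
  refine Measurable.measure_of_isPiSystem_of_isProbabilityMeasure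
    generateFrom_squareCylinders.symm
    (isPiSystem_squareCylinders (fun _ => MeasurableSpace.isPiSystem_measurableSet) (by simp)) ?_
  rintro _ ⟨I, t, -, rfl⟩
  simp only [Simplex.iidLaw, Measure.infinitePi_pi _ fun i _ => MeasurableSet.of_discrete]
  exact Finset.measurable_prod _ fun i _ => measurable_edgeLaw_apply _

/-- The kernel from the simplex to i.i.d. sequences of edges. -/
noncomputable def iidKernel : Kernel Simplex (ℕ → List ℕ) := ⟨Simplex.iidLaw, measurable_iidLaw⟩

instance : IsMarkovKernel iidKernel :=
  ⟨fun f => inferInstanceAs (IsProbabilityMeasure f.iidLaw)⟩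

theorem Simplex.iidLaw_map_restrict (f : Simplex) (n : ℕ) :
    f.iidLaw.map (fun x (i : Fin n) => x i) = Measure.pi fun _ => f.edgeLaw := by
  refine (Measure.pi_eq fun t ht => ?_).symm
  have hm : Measurable fun (x : ℕ → List ℕ) (i : Fin n) => x i := by fun_prop
  rw [Measure.map_apply hm (.univ_pi ht)]
  have e : (fun (x : ℕ → List ℕ) (i : Fin n) => x i) ⁻¹' Set.pi Set.univ t =
      Set.pi (Finset.range n : Set ℕ) fun i => if h : i < n then t ⟨i, h⟩ else Set.univ := by
    ext x
    simp only [Set.mem_preimage, Set.mem_pi, Set.mem_univ, true_imp_iff, Finset.coe_range,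
      Set.mem_Iio]
    constructor
    · intro h i hi
      rw [dif_pos hi]
      exact h ⟨i, hi⟩
    · intro h i
      simpa only [dif_pos i.2] using h i i.2
  rw [e, iidLaw, Measure.infinitePi_pi _ fun i _ => .of_discrete, Finset.prod_range]
  exact Finset.prod_congr rfl fun i _ => by rw [dif_pos i.2]

theorem Simplex.iidLaw_restrict_eq (f : Simplex) {n : ℕ} (s : Fin n → List ℕ) :
    f.iidLaw {x | ∀ i : Fin n, x i = s i} = ∏ i, (f.1 (s i) : ℝ≥0∞) := by
  have hm : Measurable fun (x : ℕ → List ℕ) (i : Fin n) => x i := by fun_prop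
  have h := Measure.map_apply (μ := f.iidLaw) hm (measurableSet_singleton s)
  rw [f.iidLaw_map_restrict, Measure.pi_singleton] at h
  simp only [edgeLaw_singleton] at h
  rw [h]
  congr 1
  ext x
  exact funext_iff.symm

theorem Simplex.iidLaw_restrict_mem (f : Simplex) {n : ℕ} (B : Set (Fin n → List ℕ)) :
    f.iidLaw {x | (fun i : Fin n => x i) ∈ B} =
      ∑' s, B.indicator (fun s => ∏ i, (f.1 (s i) : ℝ≥0∞)) s := by
  have hm : Measurable fun (x : ℕ → List ℕ) (i : Fin n) => x i := by fun_prop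
  have h := Measure.map_apply (μ := f.iidLaw) hm (MeasurableSet.of_discrete (s := B))
  rw [f.iidLaw_map_restrict] at h
  refine h.symm.trans ?_
  rw [← Measure.tsum_indicator_apply_singleton _ _ .of_discrete]
  simp only [Measure.pi_singleton, edgeLaw_singleton]

theorem Simplex.hasSum_prod (f : Simplex) (n : ℕ) :
    HasSum (fun s : Fin n → List ℕ => ∏ i, (f.1 (s i) : ℝ)) 1 := by
  have h := f.iidLaw_restrict_mem (n := n) Set.univ
  simp only [Set.mem_univ, Set.ofPred_true, measure_univ, Set.indicator_univ] at h
  have h1 : HasSum (fun s : Fin n → List ℕ => ((∏ i, f.1 (s i) : ℝ≥0) : ℝ≥0∞)) 1 := by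
    rw [h]
    push_cast
    exact ENNReal.summable.hasSum
  rw [← ENNReal.coe_one] at h1
  simpa using NNReal.hasSum_coe.2 (ENNReal.hasSum_coe.1 h1)

theorem Simplex.toReal_iidLaw_restrict_mem (f : Simplex) {n : ℕ} (B : Set (Fin n → List ℕ)) :
    (f.iidLaw {x | (fun i : Fin n => x i) ∈ B}).toReal =
      ∑' s, B.indicator (fun s => ∏ i, (f.1 (s i) : ℝ)) s := by
  rw [f.iidLaw_restrict_mem, ENNReal.tsum_toReal_eq]
  · refine tsum_congr fun s => ?_
    by_cases h : s ∈ B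
    · simp [Set.indicator_of_mem h, ENNReal.toReal_prod]
    · simp [Set.indicator_of_notMem h]
  · intro s
    by_cases h : s ∈ B
    · rw [Set.indicator_of_mem h]
      exact ENNReal.prod_ne_top fun _ _ => ENNReal.coe_ne_top
    · simp [Set.indicator_of_notMem h]

theorem Simplex.ae_tendsto_weight (f : Simplex) (v : ℕ) :
    ∀ᵐ x ∂f.iidLaw, Tendsto (proportion fun i => v ∈ x i) atTop (𝓝 (weight f v : ℝ)) := by
  have hm : Measurable fun s : List ℕ => ind (v ∈ s) := .of_discrete
  have hmi : ∀ i, Measurable fun x : ℕ → List ℕ => ind (v ∈ x i) := fun i =>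
    hm.comp (measurable_pi_apply i)
  have hmap : ∀ i, f.iidLaw.map (fun x => ind (v ∈ x i)) = f.edgeLaw.map fun s => ind (v ∈ s) :=
    fun i => by
      conv_rhs => rw [← Measure.infinitePi_map_eval (fun _ : ℕ => f.edgeLaw) i,
        Measure.map_map hm (measurable_pi_apply i)]
      rfl
  have h := strong_law_ae_real (μ := f.iidLaw) (fun i x => ind (v ∈ x i))
    (Integrable.of_bound (hmi 0).aestronglyMeasurable 1 (ae_of_all _ fun x => by
      rw [Real.norm_of_nonneg (ind_nonneg _)]; exact ind_le_one _))
    (fun i j hij => (iIndepFun_infinitePi (P := fun _ : ℕ => f.edgeLaw)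
      (X := fun _ s => ind (v ∈ s)) fun _ => hm).indepFun hij)
    (fun i => ⟨(hmi i).aemeasurable, (hmi 0).aemeasurable, by rw [hmap, hmap]⟩)
  have hE : ∫ x, ind (v ∈ x 0) ∂f.iidLaw = weight f v := by
    rw [integral_ind (p := fun x : ℕ → List ℕ => v ∈ x 0)
      (measurable_pi_apply (0 : ℕ) (MeasurableSet.of_discrete (s := {s : List ℕ | v ∈ s}))),
      measureReal_def]
    have h0 := Measure.map_apply (μ := f.iidLaw) (measurable_pi_apply 0)
      (MeasurableSet.of_discrete (s := {s : List ℕ | v ∈ s}))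
    rw [iidLaw, Measure.infinitePi_map_eval, ← coe_weight] at h0
    exact (congrArg ENNReal.toReal h0).symm
  filter_upwards [h] with x hx
  rw [hE] at hx
  exact hx.congr fun n => (proportion_eq_sum _ n).symm

/-! ### The representation of an edge exchangeable law -/

open Classical in
/-- The edge frequencies of a network as a point of the simplex (an arbitrary point if they do not
add up to one). -/
noncomputable def Network.simplex (E : Network ℕ) : Simplex :=
  if h : ∑' s, ENNReal.ofReal (E.edgeFreq s) = 1 then
    ⟨fun s => (E.edgeFreq s).toNNReal, ENNReal.hasSum_coe.1 (by
      rw [ENNReal.coe_one, ← h]; exact ENNReal.summable.hasSum)⟩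
  else ⟨Pi.single [] 1, hasSum_pi_single _ _⟩

theorem Network.Regular.simplex_apply {E : Network ℕ} (hE : E.Regular) (s : List ℕ) :
    (E.simplex.1 s : ℝ) = E.edgeFreq s := by
  have h : ∑' s, ENNReal.ofReal (E.edgeFreq s) = 1 := by
    rw [← ENNReal.ofReal_tsum_of_nonneg hE.edgeFreq_nonneg hE.hasSum.summable, hE.hasSum.tsum_eq,
      ENNReal.ofReal_one]
  rw [Network.simplex, dif_pos h]
  exact Real.coe_toNNReal _ (hE.edgeFreq_nonneg s)

theorem measurable_simplex : Measurable Network.simplex := by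
  classical
  have hm : MeasurableSet {E : Network ℕ | ∑' s, ENNReal.ofReal (E.edgeFreq s) = 1} :=
    (Measurable.tsum fun s => (measurable_edgeFreq_apply s).ennreal_ofReal)
      (measurableSet_singleton 1)
  have h : Measurable fun E : Network ℕ => (E.simplex).1 := by
    have e : (fun E : Network ℕ => (E.simplex).1) = fun E =>
        if ∑' s, ENNReal.ofReal (E.edgeFreq s) = 1 then
          fun s => (E.edgeFreq s).toNNReal else Pi.single [] 1 := by
      funext E
      by_cases hE : ∑' s, ENNReal.ofReal (E.edgeFreq s) = 1
      · rw [if_pos hE, Network.simplex, dif_pos hE]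
      · rw [if_neg hE, Network.simplex, dif_neg hE]
    rw [e]
    exact Measurable.ite hm
      (measurable_pi_lambda _ fun s => (measurable_edgeFreq_apply s).real_toNNReal)
      measurable_const
  exact h.subtype_mk

/-- The indicator is a product over coordinates, so its average over a box factors: the empirical
form of a product law. -/
theorem avg_piFinset {n : ℕ} (S : Fin n → Finset ℕ) (z : ℕ → List ℕ) (s : Fin n → List ℕ) :
    avg (Fintype.piFinset S) (fun t => (fun j => z (t j)) = s) =
      ∏ j, avg (S j) fun i => z i = s j := by
  have e : ∀ t : Fin n → ℕ, ind ((fun j => z (t j)) = s) = ∏ j, ind (z (t j) = s j) := by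
    intro t
    by_cases h : ∀ j, z (t j) = s j
    · rw [ind_of_true (funext h), Finset.prod_eq_one fun j _ => ind_of_true (h j)]
    · rw [ind_of_false fun hs => h (congrFun hs)]
      obtain ⟨j, hj⟩ := not_forall.1 h
      exact (Finset.prod_eq_zero (Finset.mem_univ j) (ind_of_false hj)).symm
  unfold avg
  simp only [e, Finset.prod_div_distrib, Finset.prod_univ_sum, Fintype.card_piFinset,
    Nat.cast_prod]

/-- The law of the network induced by i.i.d. edges, given their random distribution. -/
theorem ExchLaw.map_network_eq {ν : Measure (Network ℕ)} [IsProbabilityMeasure ν]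
    (hν : ExchLaw ν) (hreg : ∀ᵐ E ∂ν, E.Regular) :
    (ν.map Network.simplex ⊗ₘ iidKernel).map (fun ω => Interactions.network ω.2) = ν := by
  have : IsProbabilityMeasure (ν.map Network.simplex) :=
    Measure.isProbabilityMeasure_map measurable_simplex.aemeasurable
  have hmeas : Measurable fun ω : Simplex × (ℕ → List ℕ) => Interactions.network ω.2 :=
    measurable_network.comp measurable_snd
  have : IsProbabilityMeasure
      ((ν.map Network.simplex ⊗ₘ iidKernel).map fun ω => Interactions.network ω.2) :=
    Measure.isProbabilityMeasure_map hmeas.aemeasurable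
  refine ext_of_restrict fun n F => ?_
  set B : Set (Fin n → List ℕ) := {s | Interactions.network s = F} with hB
  have hBm : MeasurableSet {x : ℕ → List ℕ | (fun i : Fin n => x i) ∈ B} := by
    have hm : Measurable fun (x : ℕ → List ℕ) (i : Fin n) => x i := by fun_prop
    exact hm (MeasurableSet.of_discrete (s := B))
  have hF : MeasurableSet {E : Network ℕ | E.restrict n = F} :=
    measurableSet_of_restrict n fun E G h (hE : _ = _) => show _ = _ from h ▸ hE
  have hpre : (fun ω : Simplex × (ℕ → List ℕ) => Interactions.network ω.2) ⁻¹'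
      {E | E.restrict n = F} = Prod.snd ⁻¹' {x | (fun i : Fin n => x i) ∈ B} := rfl
  have hlhs : ((ν.map Network.simplex ⊗ₘ iidKernel).map (fun ω => Interactions.network ω.2))
      {E | E.restrict n = F} =
      ∫⁻ E, E.simplex.iidLaw {x | (fun i : Fin n => x i) ∈ B} ∂ν := by
    rw [Measure.map_apply hmeas hF, hpre, Measure.compProd_apply (measurable_snd hBm)]
    exact lintegral_map (iidKernel.measurable_coe hBm) measurable_simplex
  -- `B` collects all representatives of one finite network, so membership ignores vertex labels and
  -- exchangeability applies.
  have hQ : ∀ I J : Interactions (Fin n), SameNetwork I J → (I ∈ B ↔ J ∈ B) := fun I J h => by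
    simp only [hB, Set.mem_ofPred_eq, show I.network = J.network from Quotient.sound h]
  have hrhs : {E : Network ℕ | E.restrict n = F} = {E | (fun i : Fin n => E.canon i) ∈ B} := by
    ext E
    rw [Set.mem_ofPred_eq, restrict_eq]
    rfl
  -- Coordinate `j` ranges over the block `[j * N, (j + 1) * N)`. The tuples are then automatically
  -- injective, as exchangeability needs, and form a box, so that averages factor.
  set S : ℕ → Finset (Fin n → ℕ) := fun N =>
    Fintype.piFinset fun j : Fin n => Finset.Ico ((j : ℕ) * N) (((j : ℕ) + 1) * N) with hS
  have hSne : ∀ᶠ N in atTop, (S N).Nonempty := by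
    filter_upwards [eventually_gt_atTop 0] with N hN
    refine Fintype.piFinset_nonempty.2 fun j => Finset.nonempty_Ico.2 ?_
    rw [Nat.succ_mul]
    omega
  have hinj : ∀ N, ∀ t ∈ S N, Function.Injective t := by
    intro N t ht i j hij
    have hi := Finset.mem_Ico.1 (Fintype.mem_piFinset.1 ht i)
    have hj := Finset.mem_Ico.1 (Fintype.mem_piFinset.1 ht j)
    rw [hij] at hi
    have h1 : (i : ℕ) < j + 1 := lt_of_mul_lt_mul_right (hi.1.trans_lt hj.2) (Nat.zero_le N)
    have h2 : (j : ℕ) < i + 1 := lt_of_mul_lt_mul_right (hj.1.trans_lt hi.2) (Nat.zero_le N)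
    exact Fin.ext (by omega)
  have hp : ∀ t : Fin n → ℕ, MeasurableSet {E : Network ℕ | (fun j => E.canon (t j)) ∈ B} :=
    fun t => (measurable_pi_lambda _ fun j => measurable_canon_apply (t j) :
      Measurable fun (E : Network ℕ) (j : Fin n) => E.canon (t j))
        (MeasurableSet.of_discrete (s := B))
  have hint := integral_eq_of_tendsto_avg (P := ν) (S := S)
    (p := fun t E => (fun j => E.canon (t j)) ∈ B)
    (g := fun E => (E.simplex.iidLaw {x | (fun i : Fin n => x i) ∈ B}).toReal)
    (c := ν.real {E | (fun i : Fin n => E.canon i) ∈ B}) hSne hp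
    (Eventually.of_forall fun N t ht => congrArg ENNReal.toReal
      (hν.measure_injective hQ (hinj N t ht) Fin.val_injective)) ?_
  · have hm : Measurable fun E : Network ℕ =>
        E.simplex.iidLaw {x | (fun i : Fin n => x i) ∈ B} :=
      (iidKernel.measurable_coe hBm).comp measurable_simplex
    rw [integral_toReal hm.aemeasurable (ae_of_all _ fun E => measure_lt_top _ _),
      measureReal_def, ENNReal.toReal_eq_toReal_iff' _ (measure_ne_top _ _)] at hint
    · rw [hlhs, hint, hrhs]
    · rw [← hlhs]
      exact measure_ne_top _ _
  · filter_upwards [hreg] with E hE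
    rw [Simplex.toReal_iidLaw_restrict_mem]
    refine tendsto_avg_mem (z := fun t : Fin n → ℕ => fun j => E.canon (t j)) hSne
      (E.simplex.hasSum_prod n) (fun s => ?_) B
    simp only [hS, avg_piFinset, hE.simplex_apply]
    exact tendsto_finsetProd _ fun j _ => tendsto_avg_block (hE.tendsto (s j)) j

/-- Sampling independently from a random distribution. -/
theorem iidGiven_compProd (ρ : Measure Simplex) [IsProbabilityMeasure ρ] :
    IIDGiven (ρ ⊗ₘ iidKernel) Prod.fst Prod.snd where
  measurable_f := measurable_fst
  measurable_X i s := measurableSet_eq_fun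
    ((measurable_pi_apply i).comp measurable_snd) measurable_const
  law C hC n s := by
    have hT : MeasurableSet {x : ℕ → List ℕ | ∀ i : Fin n, x i = s i} := by
      have hm : Measurable fun (x : ℕ → List ℕ) (i : Fin n) => x i := by fun_prop
      have := hm (measurableSet_singleton s)
      convert! this using 1
      ext x
      exact funext_iff.symm
    have hg : Measurable fun f : Simplex => ∏ i, (f.1 (s i) : ℝ≥0∞) :=
      Finset.measurable_prod _ fun i _ => measurable_coe_simplex _
    have e : {ω : Simplex × (ℕ → List ℕ) | ω.1 ∈ C ∧ ∀ i : Fin n, ω.2 i = s i} =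
        C ×ˢ {x | ∀ i : Fin n, x i = s i} := rfl
    rw [e, Measure.compProd_apply_prod hC hT,
      ← setLIntegral_map (μ := ρ ⊗ₘ iidKernel) hC hg measurable_fst]
    change _ = ∫⁻ f in C, _ ∂((ρ ⊗ₘ iidKernel).fst)
    rw [Measure.fst_compProd]
    exact lintegral_congr fun f => f.iidLaw_restrict_eq s

theorem ae_tendsto_weight (ρ : Measure Simplex) [IsProbabilityMeasure ρ] :
    ∀ᵐ ω ∂(ρ ⊗ₘ iidKernel), ∀ v : ℕ,
      Tendsto (proportion fun i => v ∈ ω.2 i) atTop (𝓝 (weight ω.1 v : ℝ)) := by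
  refine ae_all_iff.2 fun v => Measure.ae_compProd_of_ae_ae ?_ (ae_of_all _ fun f =>
    f.ae_tendsto_weight v)
  have hw : Measurable fun f : Simplex => (weight f v : ℝ) := by
    have h : Measurable fun f : Simplex => (weight f v : ℝ≥0∞) := by
      simp only [coe_weight]
      exact measurable_edgeLaw_apply _
    exact h.ennreal_toReal
  refine measurableSet_tendsto_fun (fun n => measurable_proportion (fun i => ?_) n)
    (hw.comp measurable_fst)
  exact ((measurable_pi_apply i).comp measurable_snd)
    (MeasurableSet.of_discrete (s := {s : List ℕ | v ∈ s}))

/-! ### Size-biased arrivals for independent edges -/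

section Prefix

variable {n : ℕ} {H : Set (ℕ → List ℕ)}

theorem eq_preimage_restrict (hH : ∀ x y, (∀ j < n, x j = y j) → x ∈ H → y ∈ H) :
    H = (fun (x : ℕ → List ℕ) (i : Finset.range n) => x i) ⁻¹'
      ((fun (x : ℕ → List ℕ) (i : Finset.range n) => x i) '' H) := by
  ext y
  constructor
  · exact fun hy => ⟨y, hy, rfl⟩
  · rintro ⟨x, hx, hxy⟩
    exact hH x y (fun j hj => congrFun hxy ⟨j, Finset.mem_range.2 hj⟩) hx

theorem measurableSet_of_prefix (hH : ∀ x y, (∀ j < n, x j = y j) → x ∈ H → y ∈ H) :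
    MeasurableSet H := by
  rw [eq_preimage_restrict hH]
  have hm : Measurable fun (x : ℕ → List ℕ) (i : Finset.range n) => x i := by fun_prop
  exact hm .of_discrete

/-- `H` is determined by the edges before `n`, which are independent of edge `n`. -/
theorem Simplex.iidLaw_inter (f : Simplex) (hH : ∀ x y, (∀ j < n, x j = y j) → x ∈ H → y ∈ H)
    (D : Set (List ℕ)) : f.iidLaw (H ∩ {x | x n ∈ D}) = f.iidLaw H * f.edgeLaw D := by
  have hD : f.iidLaw {x | x n ∈ D} = f.edgeLaw D := by
    have h := Measure.map_apply (μ := f.iidLaw) (measurable_pi_apply n)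
      (MeasurableSet.of_discrete (s := D))
    rw [iidLaw, Measure.infinitePi_map_eval] at h
    exact h.symm
  have hind := (iIndepFun_infinitePi (P := fun _ : ℕ => f.edgeLaw) (X := fun _ s => s)
    fun _ => measurable_id).indepFun_finset (Finset.range n) {n} (by simp)
    (fun i => measurable_pi_apply i)
  have h := hind.measure_inter_preimage_eq_mul
    ((fun (x : ℕ → List ℕ) (i : Finset.range n) => x i) '' H)
    {y | y ⟨n, Finset.mem_singleton_self n⟩ ∈ D} .of_discrete .of_discrete
  rw [← eq_preimage_restrict hH] at h
  rw [← hD]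
  exact h

end Prefix

theorem newVerts_congr {x y : Interactions ℕ} {i : ℕ} (h : ∀ j ≤ i, x j = y j) :
    newVerts x i = newVerts y i := by
  ext v
  simp only [newVerts, Set.mem_ofPred_eq, h i le_rfl]
  exact and_congr_right fun _ => forall₂_congr fun j hj => by rw [h j hj.le]

open Classical in
/-- The number of edges with new vertices among the first `i` ones. -/
noncomputable def batchCount (x : Interactions ℕ) (i : ℕ) : ℕ :=
  Nat.count (fun j => (newVerts x j).Nonempty) i

theorem mem_batch {x : Interactions ℕ} {k v : ℕ} :
    v ∈ batch x k ↔ ∃ i, v ∈ newVerts x i ∧ batchCount x i = k := Iff.rfl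

theorem batchCount_mono (x : Interactions ℕ) : Monotone (batchCount x) := by
  classical
  exact Nat.count_monotone _

theorem batchCount_succ {x : Interactions ℕ} {i : ℕ} (h : (newVerts x i).Nonempty) :
    batchCount x (i + 1) = batchCount x i + 1 := by
  classical
  rw [batchCount, Nat.count_succ, if_pos h]
  rfl

theorem batchCount_succ_of_not {x : Interactions ℕ} {i : ℕ} (h : ¬ (newVerts x i).Nonempty) :
    batchCount x (i + 1) = batchCount x i := by
  classical
  rw [batchCount, Nat.count_succ, if_neg h]
  rfl

theorem batchCount_congr {x y : Interactions ℕ} {i : ℕ} (h : ∀ j < i, x j = y j) :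
    batchCount x i = batchCount y i := by
  induction i with
  | zero => rfl
  | succ i ih =>
    have hn : newVerts x i = newVerts y i := newVerts_congr fun j hj => h j (by omega)
    have hi := ih fun j hj => h j (by omega)
    by_cases hne : (newVerts x i).Nonempty
    · rw [batchCount_succ hne, batchCount_succ (hn ▸ hne), hi]
    · rw [batchCount_succ_of_not hne, batchCount_succ_of_not (hn ▸ hne), hi]

/-- Every vertex that occurs is new in its first edge. -/
theorem exists_mem_newVerts {x : Interactions ℕ} {i u : ℕ} (h : u ∈ x i) :
    ∃ m ≤ i, u ∈ newVerts x m := by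
  classical
  have hex : ∃ m, u ∈ x m := ⟨i, h⟩
  exact ⟨Nat.find hex, Nat.find_min' hex h, Nat.find_spec hex, fun j hj => Nat.find_min hex hj⟩

/-- The first `k` batches are `A` and they have arrived, as the only ones, before edge `i`. -/
def arrivedAt {k : ℕ} (A : Fin k → Finset ℕ) (i : ℕ) : Set (ℕ → List ℕ) :=
  {x | batchCount x i = k ∧
    ∀ j : Fin k, {v | ∃ m < i, v ∈ newVerts x m ∧ batchCount x m = j} = (A j : Set ℕ)}

/-- The first `k` batches are `A`. -/
def batchesEq {k : ℕ} (A : Fin k → Finset ℕ) : Set (ℕ → List ℕ) :=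
  {x | ∀ j : Fin k, batch x j = A j}

section Batches

variable {k : ℕ} {A : Fin k → Finset ℕ}

theorem arrivedAt_prefix {i : ℕ} (x y : ℕ → List ℕ) (h : ∀ j < i, x j = y j)
    (hx : x ∈ arrivedAt A i) : y ∈ arrivedAt A i := by
  refine ⟨by rw [← batchCount_congr h]; exact hx.1, fun j => ?_⟩
  rw [← hx.2 j]
  ext v
  refine exists_congr fun m => and_congr_right fun hm => ?_
  rw [newVerts_congr fun l hl => h l (by omega), batchCount_congr fun l hl => h l (by omega)]

/-- The count never decreases, so once it is `k` no later edge can add to the batches numbered below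
`k`. -/
theorem mem_arrivedAt_iff {x : ℕ → List ℕ} {i : ℕ} (hi : batchCount x i = k) :
    x ∈ arrivedAt A i ↔ x ∈ batchesEq A := by
  have h : ∀ j : Fin k, {v | ∃ m < i, v ∈ newVerts x m ∧ batchCount x m = j} = batch x j := by
    intro j
    ext v
    rw [mem_batch]
    refine ⟨fun ⟨m, _, h⟩ => ⟨m, h⟩, fun ⟨m, hm, hc⟩ => ⟨m, ?_, hm, hc⟩⟩
    by_contra hmi
    have := batchCount_mono x (not_lt.1 hmi)
    have := j.2
    omega
  simp only [arrivedAt, batchesEq, Set.mem_ofPred_eq, hi, h, true_and]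

theorem mem_biUnion_iff_of_arrivedAt {x : ℕ → List ℕ} {i u : ℕ} (hx : x ∈ arrivedAt A i) :
    u ∈ Finset.univ.biUnion A ↔ ∃ j < i, u ∈ x j := by
  simp only [Finset.mem_biUnion, Finset.mem_univ, true_and]
  constructor
  · rintro ⟨j, hj⟩
    rw [← Finset.mem_coe, ← hx.2 j] at hj
    obtain ⟨m, hm, hu, -⟩ := hj
    exact ⟨m, hm, hu.1⟩
  · rintro ⟨j, hj, hu⟩
    obtain ⟨m, hmj, hm⟩ := exists_mem_newVerts hu
    have hlt : batchCount x m < k := by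
      have h1 := batchCount_succ ⟨u, hm⟩
      have h2 := batchCount_mono x (show m + 1 ≤ i by omega)
      have h3 := hx.1
      omega
    refine ⟨⟨_, hlt⟩, ?_⟩
    rw [← Finset.mem_coe, ← hx.2]
    exact ⟨m, by omega, hm, rfl⟩

theorem mem_newVerts_of_arrivedAt {x : ℕ → List ℕ} {i u : ℕ} (hx : x ∈ arrivedAt A i)
    (hu : u ∉ Finset.univ.biUnion A) (hi : u ∈ x i) : u ∈ newVerts x i :=
  ⟨hi, fun j hj h => hu ((mem_biUnion_iff_of_arrivedAt hx).2 ⟨j, hj, h⟩)⟩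

/-- An edge with a vertex outside the arrived ones raises the count beyond `k`, so the edge that
brings batch `k` is unique. -/
theorem pairwise_disjoint_arrivedAt (D : Set (List ℕ))
    (hD : D ⊆ {s | ∃ u ∈ s, u ∉ Finset.univ.biUnion A}) :
    Pairwise (Function.onFun Disjoint fun i => arrivedAt A i ∩ {x | x i ∈ D}) := by
  have key : ∀ i i', i < i' → ∀ x, x ∈ arrivedAt A i → x i ∈ D → x ∉ arrivedAt A i' := by
    intro i i' hii x hx hxD hx'
    obtain ⟨u, hu, huA⟩ := hD hxD
    have h1 := batchCount_succ ⟨u, mem_newVerts_of_arrivedAt hx huA hu⟩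
    have h2 := batchCount_mono x (show i + 1 ≤ i' by omega)
    have h3 := hx.1
    have h4 := hx'.1
    omega
  intro i i' hne
  refine Set.disjoint_left.2 fun x hx hx' => ?_
  rcases hne.lt_or_gt with h | h
  · exact key i i' h x hx.1 hx.2 hx'.1
  · exact key i' i h x hx'.1 hx'.2 hx.1

theorem batchesEq_inter_mem {v : ℕ} (hv : v ∉ Finset.univ.biUnion A) :
    batchesEq A ∩ {x | v ∈ batch x k} = ⋃ i, arrivedAt A i ∩ {x | x i ∈ {s | v ∈ s}} := by
  ext x
  simp only [Set.mem_inter_iff, Set.mem_iUnion, Set.mem_ofPred_eq]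
  constructor
  · rintro ⟨hx, i, hi, hc⟩
    exact ⟨i, (mem_arrivedAt_iff hc).2 hx, hi.1⟩
  · rintro ⟨i, hx, hi⟩
    exact ⟨(mem_arrivedAt_iff hx.1).1 hx, i, mem_newVerts_of_arrivedAt hx hv hi, hx.1⟩

theorem batchesEq_inter_nonempty : batchesEq A ∩ {x | (batch x k).Nonempty} =
    ⋃ i, arrivedAt A i ∩ {x | x i ∈ {s | ∃ u ∈ s, u ∉ Finset.univ.biUnion A}} := by
  ext x
  simp only [Set.mem_inter_iff, Set.mem_iUnion, Set.mem_ofPred_eq]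
  constructor
  · rintro ⟨hx, u, i, hi, hc⟩
    have hx' := (mem_arrivedAt_iff hc).2 hx
    refine ⟨i, hx', u, hi.1, fun hu => ?_⟩
    obtain ⟨j, hj, h⟩ := (mem_biUnion_iff_of_arrivedAt hx').1 hu
    exact hi.2 j hj h
  · rintro ⟨i, hx, u, hi, hu⟩
    exact ⟨(mem_arrivedAt_iff hx.1).1 hx, u, i, mem_newVerts_of_arrivedAt hx hu hi, hx.1⟩

/-- If batch `k` is empty, the count never exceeds `k`, and every vertex belongs to an earlier
batch. -/
theorem mem_biUnion_of_batch_eq_empty {x : ℕ → List ℕ} (hx : x ∈ batchesEq A)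
    (hk : ¬ (batch x k).Nonempty) (i : ℕ) {u : ℕ} (hu : u ∈ x i) :
    u ∈ Finset.univ.biUnion A := by
  have hle : ∀ m, batchCount x m ≤ k := by
    intro m
    induction m with
    | zero => exact Nat.zero_le k
    | succ m ih =>
      by_cases hne : (newVerts x m).Nonempty
      · have hnk : batchCount x m ≠ k := fun hc =>
          hk (hne.mono fun v hv => ⟨m, hv, hc⟩)
        rw [batchCount_succ hne]
        omega
      · rwa [batchCount_succ_of_not hne]
  obtain ⟨m, -, hm⟩ := exists_mem_newVerts hu
  have hlt : batchCount x m < k :=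
    lt_of_le_of_ne (hle m) fun hc => hk ⟨u, m, hm, hc⟩
  refine Finset.mem_biUnion.2 ⟨⟨_, hlt⟩, Finset.mem_univ _, ?_⟩
  rw [← Finset.mem_coe, ← hx ⟨_, hlt⟩]
  exact ⟨m, hm, rfl⟩

theorem measurableSet_arrivedAt_inter (D : Set (List ℕ)) (i : ℕ) :
    MeasurableSet (arrivedAt A i ∩ {x | x i ∈ D}) :=
  (measurableSet_of_prefix arrivedAt_prefix).inter
    (measurable_pi_apply i (MeasurableSet.of_discrete (s := D)))

theorem measurableSet_mem_batch (v j : ℕ) : MeasurableSet {x : ℕ → List ℕ | v ∈ batch x j} := by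
  have : {x : ℕ → List ℕ | v ∈ batch x j} =
      ⋃ i, {x | v ∈ newVerts x i ∧ batchCount x i = j} := by
    ext x
    simp [mem_batch]
  rw [this]
  refine MeasurableSet.iUnion fun i => measurableSet_of_prefix (n := i + 1) fun x y h hx => ?_
  rw [Set.mem_ofPred_eq] at hx ⊢
  rwa [← newVerts_congr fun l hl => h l (by omega), ← batchCount_congr fun l hl => h l (by omega)]

theorem measurableSet_batchesEq : MeasurableSet (batchesEq A) := by
  have : batchesEq A = ⋂ j : Fin k, ⋂ v : ℕ, {x | v ∈ batch x j ↔ v ∈ A j} := by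
    ext x
    simp [batchesEq, Set.ext_iff]
  rw [this]
  exact MeasurableSet.iInter fun j => MeasurableSet.iInter fun v =>
    (measurableSet_mem_batch v j).iff (.const _)

end Batches

/-- The first `n` edges alone lie in `D` with probability `f.edgeLaw D ^ n`, which tends to 0. -/
theorem Simplex.iidLaw_forall_mem (f : Simplex) {D : Set (List ℕ)} (hD : f.edgeLaw D < 1) :
    f.iidLaw {x | ∀ i, x i ∈ D} = 0 := by
  have h : ∀ n : ℕ, f.iidLaw {x | ∀ i, x i ∈ D} ≤ f.edgeLaw D ^ n := by
    intro n
    have hp : f.iidLaw (Set.pi (Finset.range n : Set ℕ) fun _ => D) = f.edgeLaw D ^ n := by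
      rw [iidLaw, Measure.infinitePi_pi _ fun i _ => .of_discrete, Finset.prod_const,
        Finset.card_range]
    rw [← hp]
    exact measure_mono fun x hx i _ => hx i
  exact le_antisymm (ge_of_tendsto' (ENNReal.tendsto_pow_atTop_nhds_zero_of_lt_one hD) h)
    (zero_le)

/-- Size-biased arrival for independent edges with distribution `f`. -/
theorem Simplex.iidLaw_batchesEq_inter_mem (f : Simplex) {k : ℕ} (A : Fin k → Finset ℕ) {v : ℕ}
    (hv : v ∉ Finset.univ.biUnion A) :
    f.iidLaw (batchesEq A ∩ {x | v ∈ batch x k}) =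
      (weight f v : ℝ≥0∞) / (newMass f (Finset.univ.biUnion A) : ℝ≥0∞) *
        f.iidLaw (batchesEq A) := by
  set U := Finset.univ.biUnion A with hU
  set D : Set (List ℕ) := {s | ∃ u ∈ s, u ∉ U} with hDdef
  have hsub : {s : List ℕ | v ∈ s} ⊆ D := fun s hs => ⟨v, hs, hv⟩
  have h1 : f.iidLaw (batchesEq A ∩ {x | v ∈ batch x k}) =
      (∑' i, f.iidLaw (arrivedAt A i)) * weight f v := by
    rw [batchesEq_inter_mem hv, measure_iUnion (pairwise_disjoint_arrivedAt _ hsub)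
      fun i => measurableSet_arrivedAt_inter _ i, ← ENNReal.tsum_mul_right, coe_weight]
    exact tsum_congr fun i => f.iidLaw_inter arrivedAt_prefix _
  have h2 : f.iidLaw (batchesEq A ∩ {x | (batch x k).Nonempty}) =
      (∑' i, f.iidLaw (arrivedAt A i)) * newMass f U := by
    rw [batchesEq_inter_nonempty, measure_iUnion (pairwise_disjoint_arrivedAt _ subset_rfl)
      fun i => measurableSet_arrivedAt_inter _ i, ← ENNReal.tsum_mul_right, coe_newMass]
    exact tsum_congr fun i => f.iidLaw_inter arrivedAt_prefix _
  have hle : (weight f v : ℝ≥0∞) ≤ newMass f U := by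
    rw [coe_weight, coe_newMass]
    exact measure_mono hsub
  -- In the degenerate case the weight vanishes too, and `0 / 0 = 0` agrees with the left side.
  by_cases h0 : (newMass f U : ℝ≥0∞) = 0
  · have hw : (weight f v : ℝ≥0∞) = 0 := le_antisymm (h0 ▸ hle) (zero_le)
    rw [h1, hw, mul_zero, ENNReal.zero_div, zero_mul]
  · have hDlt : f.edgeLaw Dᶜ < 1 := by
      rw [prob_compl_eq_one_sub .of_discrete]
      refine ENNReal.sub_lt_self ENNReal.one_ne_top one_ne_zero ?_
      rwa [← coe_newMass]
    -- When new edges have positive mass, one of them almost surely occurs, so a further batch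
    -- arrives.
    have hnull : f.iidLaw (batchesEq A \ {x | (batch x k).Nonempty}) = 0 := by
      refine measure_mono_null (t := {x | ∀ i, x i ∈ Dᶜ}) (fun x hx i => ?_) (f.iidLaw_forall_mem hDlt)
      rintro ⟨u, hu, huU⟩
      exact huU (mem_biUnion_of_batch_eq_empty hx.1 hx.2 i hu)
    have h3 : f.iidLaw (batchesEq A) = (∑' i, f.iidLaw (arrivedAt A i)) * newMass f U := by
      refine le_antisymm ?_ (h2 ▸ measure_mono Set.inter_subset_left)
      rw [← h2]
      refine (measure_le_inter_add_sdiff _ _ {x | (batch x k).Nonempty}).trans ?_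
      rw [hnull, add_zero]
    rw [h1, h3, mul_comm _ (newMass f U : ℝ≥0∞), ← mul_assoc,
      ENNReal.div_mul_cancel h0 ENNReal.coe_ne_top, mul_comm]

theorem sizeBiasedArrival_compProd (ρ : Measure Simplex) [IsProbabilityMeasure ρ] :
    SizeBiasedArrival (ρ ⊗ₘ iidKernel) Prod.fst Prod.snd := by
  intro C hC k A v hv
  have hv' : v ∉ Finset.univ.biUnion A := by simpa using hv
  have hg : Measurable fun f : Simplex =>
      (weight f v : ℝ≥0∞) / (newMass f (Finset.univ.biUnion A) : ℝ≥0∞) := by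
    simp only [coe_weight, coe_newMass]
    exact (measurable_edgeLaw_apply _).div (measurable_edgeLaw_apply _)
  have e1 : {ω : Simplex × (ℕ → List ℕ) | ω.1 ∈ C ∧ (∀ j : Fin k, batch ω.2 j = A j) ∧
      v ∈ batch ω.2 k} = C ×ˢ (batchesEq A ∩ {x | v ∈ batch x k}) := rfl
  have e2 : {ω : Simplex × (ℕ → List ℕ) | ω.1 ∈ C ∧ ∀ j : Fin k, batch ω.2 j = A j} =
      C ×ˢ batchesEq A := rfl
  rw [e1, e2, Measure.compProd_apply_prod hC
    (measurableSet_batchesEq.inter (measurableSet_mem_batch v k))]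
  refine Eq.trans (lintegral_congr fun f => ?_) (Measure.setLIntegral_compProd
    (f := fun ω => (weight ω.1 v : ℝ≥0∞) / (newMass ω.1 (Finset.univ.biUnion A) : ℝ≥0∞))
    (hg.comp measurable_fst) hC measurableSet_batchesEq).symm
  dsimp only
  rw [lintegral_const, Measure.restrict_apply_univ]
  exact f.iidLaw_batchesEq_inter_mem A hv'

/-! ### Incompatibility with vertex exchangeability -/

theorem measurable_arrivalFreq_apply (k : ℕ) : Measurable fun E : Network ℕ => E.arrivalFreq k :=
  measurable_relFreq fun i => measurableSet_canon_mem i {s | k ∈ s}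

namespace Network.Regular

variable {E : Network ℕ}

theorem arrivalFreq_nonneg (hE : E.Regular) (k : ℕ) : 0 ≤ E.arrivalFreq k :=
  ge_of_tendsto' (hE.tendsto_arrivalFreq k) fun _ => proportion_nonneg _ _

theorem arrivalFreq_le_one (hE : E.Regular) (k : ℕ) : E.arrivalFreq k ≤ 1 :=
  le_of_tendsto' (hE.tendsto_arrivalFreq k) fun _ => proportion_le_one _ _

theorem arrivalFreq_pos (hE : E.Regular) {k : ℕ} (hk : k ∈ verts E.canon) :
    0 < E.arrivalFreq k := by
  obtain ⟨i, hi⟩ := hk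
  rw [hE.arrivalFreq_eq]
  refine (hE.hasSum.summable.indicator _).tsum_pos
    (fun s => Set.indicator_nonneg (fun s _ => hE.edgeFreq_nonneg s) s) (E.canon i) ?_
  rw [Set.indicator_of_mem (show E.canon i ∈ {s : List ℕ | k ∈ s} from hi)]
  exact hE.pos i

/-- Each list has finitely many entries, so each term is eventually zero as `k` grows; the summable
edge frequencies dominate. The threshold `s.sum` is a convenient bound for the entries of `s`. -/
theorem tendsto_arrivalFreq_zero (hE : E.Regular) : Tendsto E.arrivalFreq atTop (𝓝 0) := by
  have h : Tendsto (fun k => ∑' s, Set.indicator {s : List ℕ | k ∈ s} E.edgeFreq s) atTop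
      (𝓝 (∑' _ : List ℕ, (0 : ℝ))) := by
    refine tendsto_tsum_of_dominated_convergence hE.hasSum.summable (fun s => ?_)
      (Eventually.of_forall fun k s => ?_)
    · refine tendsto_const_nhds.congr' ?_
      filter_upwards [eventually_gt_atTop s.sum] with k hk
      refine (Set.indicator_of_notMem (fun hks => ?_) _).symm
      exact absurd (List.single_le_sum (fun _ _ => Nat.zero_le _) k hks) (not_le.2 hk)
    · refine (norm_indicator_le_norm_self _ _).trans (le_of_eq ?_)
      exact Real.norm_of_nonneg (hE.edgeFreq_nonneg s)
  rw [tsum_zero] at h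
  exact h.congr fun k => (hE.arrivalFreq_eq k).symm

theorem ofReal_arrivalFreq (hE : E.Regular) (k : ℕ) : ENNReal.ofReal (E.arrivalFreq k) =
    ∑' s, Set.indicator {s : List ℕ | k ∈ s} (fun s => ENNReal.ofReal (E.edgeFreq s)) s := by
  rw [hE.arrivalFreq_eq, ENNReal.ofReal_tsum_of_nonneg
    (fun s => Set.indicator_nonneg (fun s _ => hE.edgeFreq_nonneg s) s)
    (hE.hasSum.summable.indicator _)]
  refine tsum_congr fun s => ?_
  by_cases h : s ∈ {s : List ℕ | k ∈ s}
  · rw [Set.indicator_of_mem h, Set.indicator_of_mem h]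
  · rw [Set.indicator_of_notMem h, Set.indicator_of_notMem h, ENNReal.ofReal_zero]

/-- The bijection `s ↦ s.map π` of lists carries those containing `k` to those containing `π k`. -/
theorem ofReal_arrivalFreq_perm (hE : E.Regular) (π : Equiv.Perm ℕ) (k : ℕ) :
    ENNReal.ofReal (E.arrivalFreq (π k)) = ∑' s, Set.indicator {s : List ℕ | k ∈ s}
      (fun s => ENNReal.ofReal (E.edgeFreq (s.map π))) s := by
  rw [hE.ofReal_arrivalFreq, ← (Equiv.listEquivOfEquiv π).tsum_eq]
  refine tsum_congr fun s => ?_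
  have hmem : Equiv.listEquivOfEquiv π s ∈ {s : List ℕ | π k ∈ s} ↔ s ∈ {s : List ℕ | k ∈ s} :=
    List.mem_map_of_injective π.injective
  by_cases h : s ∈ {s : List ℕ | k ∈ s}
  · rw [Set.indicator_of_mem h, Set.indicator_of_mem (hmem.2 h)]
    rfl
  · rw [Set.indicator_of_notMem h, Set.indicator_of_notMem (mt hmem.1 h)]

end Network.Regular

/-- Equal expectations of the arrival frequencies force these to vanish. -/
theorem ae_arrivalFreq_eq_zero {Ω : Type*} [MeasurableSpace Ω] {P : Measure Ω}
    [IsProbabilityMeasure P] {Y : Ω → Network ℕ} (hY : Measurable Y)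
    (hreg : ∀ᵐ ω ∂P, (Y ω).Regular)
    (h : ∀ k, ∫⁻ ω, ENNReal.ofReal ((Y ω).arrivalFreq k) ∂P =
      ∫⁻ ω, ENNReal.ofReal ((Y ω).arrivalFreq 0) ∂P) :
    ∀ᵐ ω ∂P, ∀ k, (Y ω).arrivalFreq k = 0 := by
  have hm : ∀ k, Measurable fun ω => ENNReal.ofReal ((Y ω).arrivalFreq k) := fun k =>
    ((measurable_arrivalFreq_apply k).comp hY).ennreal_ofReal
  have hlim : Tendsto (fun k => ∫⁻ ω, ENNReal.ofReal ((Y ω).arrivalFreq k) ∂P) atTop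
      (𝓝 (∫⁻ _, 0 ∂P)) := by
    refine tendsto_lintegral_of_dominated_convergence (fun _ => 1) hm (fun k => ?_) (by simp) ?_
    · filter_upwards [hreg] with ω hω
      exact ENNReal.ofReal_le_one.2 (hω.arrivalFreq_le_one k)
    · filter_upwards [hreg] with ω hω
      simpa using ENNReal.tendsto_ofReal hω.tendsto_arrivalFreq_zero
  simp only [h, lintegral_zero] at hlim
  -- The means do not depend on `k` and tend to 0, so their common value is 0.
  have h0 := tendsto_nhds_unique tendsto_const_nhds hlim
  refine ae_all_iff.2 fun k => ?_
  have hk := (lintegral_eq_zero_iff (hm k)).1 ((h k).trans h0)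
  filter_upwards [hk, hreg] with ω h1 h2
  exact le_antisymm (ENNReal.ofReal_eq_zero.1 h1) (h2.arrivalFreq_nonneg k)

section Exchangeable

variable {Ω : Type*} [MeasurableSpace Ω] {P : Measure Ω} {Y : Ω → Network ℕ}

theorem ExchangeableArrival.lintegral_eq (hY : Measurable Y) (h : ExchangeableArrival P Y)
    (k : ℕ) : ∫⁻ ω, ENNReal.ofReal ((Y ω).arrivalFreq k) ∂P =
      ∫⁻ ω, ENNReal.ofReal ((Y ω).arrivalFreq 0) ∂P := by
  have hm : ∀ k, Measurable fun ω => (Y ω).arrivalFreq k := fun k =>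
    (measurable_arrivalFreq_apply k).comp hY
  have hg : Measurable fun w : ℕ → ℝ => ENNReal.ofReal (w 0) :=
    (measurable_pi_apply 0).ennreal_ofReal
  have e := congrArg (fun ρ => ∫⁻ w, ENNReal.ofReal (w 0) ∂ρ) (h (Equiv.swap 0 k))
  rw [lintegral_map hg (measurable_pi_lambda _ fun i => hm _),
    lintegral_map hg (measurable_pi_lambda _ fun i => hm _)] at e
  simpa only [Equiv.swap_apply_left] using e

/-- In a regular network the frequency of vertex 0 is a measurable functional of the edge weights,
and swapping 0 and `k` turns it into the frequency of vertex `k`. -/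
theorem VertexExchangeable.lintegral_eq (hY : Measurable Y) (hreg : ∀ᵐ ω ∂P, (Y ω).Regular)
    (h : VertexExchangeable P Y) (k : ℕ) :
    ∫⁻ ω, ENNReal.ofReal ((Y ω).arrivalFreq k) ∂P =
      ∫⁻ ω, ENNReal.ofReal ((Y ω).arrivalFreq 0) ∂P := by
  have hm : ∀ s, Measurable fun ω => (Y ω).edgeFreq s := fun s =>
    (measurable_edgeFreq_apply s).comp hY
  have hg : Measurable fun g : List ℕ → ℝ =>
      ∑' s, Set.indicator {s : List ℕ | 0 ∈ s} (fun s => ENNReal.ofReal (g s)) s := by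
    refine Measurable.tsum fun s => ?_
    by_cases hs : s ∈ {s : List ℕ | 0 ∈ s}
    · simpa only [Set.indicator_of_mem hs] using (measurable_pi_apply s).ennreal_ofReal
    · simpa only [Set.indicator_of_notMem hs] using measurable_const
  have e := congrArg (fun ρ => ∫⁻ g, ∑' s, Set.indicator {s : List ℕ | 0 ∈ s}
    (fun s => ENNReal.ofReal (g s)) s ∂ρ) (h (Equiv.swap 0 k))
  rw [lintegral_map hg (measurable_pi_lambda _ fun s => hm _),
    lintegral_map hg (measurable_pi_lambda _ fun s => hm s)] at e
  refine Eq.trans (lintegral_congr_ae ?_) (e.trans (lintegral_congr_ae ?_))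
  · filter_upwards [hreg] with ω hω
    have := hω.ofReal_arrivalFreq_perm (Equiv.swap 0 k) 0
    rwa [Equiv.swap_apply_left] at this
  · filter_upwards [hreg] with ω hω
    exact (hω.ofReal_arrivalFreq 0).symm

end Exchangeable

/-- Conditionally on there being infinitely many vertices, the arrival frequencies do not vanish
almost surely. -/
theorem not_ae_cond_arrivalFreq_eq_zero {Ω : Type*} [MeasurableSpace Ω] {μ : Measure Ω}
    [IsProbabilityMeasure μ] {Y : Ω → Network ℕ} (hY : Measurable Y)
    (hreg : ∀ᵐ ω ∂μ, (Y ω).Regular) (hinf : μ {ω | (verts (Y ω).canon).Infinite} ≠ 0) :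
    ¬ ∀ᵐ ω ∂(μ[|{ω | (verts (Y ω).canon).Infinite}]), ∀ k, (Y ω).arrivalFreq k = 0 := by
  intro h
  have := cond_isProbabilityMeasure hinf
  have hm : MeasurableSet {ω | ∀ k, (Y ω).arrivalFreq k = 0} := by
    rw [Set.ofPred_forall]
    exact MeasurableSet.iInter fun k =>
      ((measurable_arrivalFreq_apply k).comp hY) (measurableSet_singleton 0)
  have h1 := (prob_compl_eq_zero_iff hm).1 h
  have h0 : μ ({ω | (verts (Y ω).canon).Infinite} ∩ {ω | ∀ k, (Y ω).arrivalFreq k = 0}) = 0 := by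
    refine measure_mono_null (t := {ω | ¬ (Y ω).Regular}) ?_ (ae_iff.1 hreg)
    rintro ω ⟨hω, h0⟩ hr
    obtain ⟨k, hk⟩ := Set.Infinite.nonempty hω
    exact (hr.arrivalFreq_pos hk).ne' (h0 k)
  rw [cond_apply' hm, h0, mul_zero] at h1
  exact zero_ne_one h1

end EdgeExch

open EdgeExch in
theorem corollary4p4 {Ω : Type*} [MeasurableSpace Ω] (μ : Measure Ω) [IsProbabilityMeasure μ]
    (Y : Ω → Network ℕ) (hY : Measurable Y) (hexch : EdgeExchangeable μ Y)
    (hblip : ∀ᵐ ω ∂μ, (Y ω).BlipFree) :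
    (∃ (Ω' : Type) (_ : MeasurableSpace Ω') (P : Measure Ω') (f : Ω' → Simplex)
        (X : Ω' → Interactions ℕ),
      IsProbabilityMeasure P ∧
      IIDGiven P f X ∧
      P.map (fun ω => (X ω).network) = μ.map Y ∧
      (∀ᵐ ω ∂P, ∀ v : ℕ,
        Tendsto (proportion fun i => v ∈ X ω i) atTop (𝓝 (weight (f ω) v : ℝ))) ∧
      SizeBiasedArrival P f X) ∧
    (∀ᵐ ω ∂μ, ∀ k : ℕ,
      Tendsto (proportion fun i => k ∈ (Y ω).canon i) atTop (𝓝 ((Y ω).arrivalFreq k))) ∧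
    (μ {ω | (verts (Y ω).canon).Infinite} ≠ 0 →
      ¬ ExchangeableArrival (μ[|{ω | (verts (Y ω).canon).Infinite}]) Y ∧
      ¬ VertexExchangeable (μ[|{ω | (verts (Y ω).canon).Infinite}]) Y) := by

  have hν : ExchLaw (μ.map Y) := hexch.exchLaw hY
  have hprob : IsProbabilityMeasure (μ.map Y) := Measure.isProbabilityMeasure_map hY.aemeasurable
  have hbf : ∀ᵐ E ∂(μ.map Y), E.BlipFree := by
    have hm : MeasurableSet {E : Network ℕ | E.BlipFree} := by
      have e : {E : Network ℕ | E.BlipFree} =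
          ⋂ i : ℕ, ⋃ j : ℕ, {E | j ≠ i ∧ E.canon j = E.canon i} := by
        ext E
        simp [Network.BlipFree]
      rw [e]
      exact MeasurableSet.iInter fun i => MeasurableSet.iUnion fun j =>
        (MeasurableSet.const _).inter (measurableSet_canon_eq j i)
    exact (ae_map_iff hY.aemeasurable hm).2 hblip
  have hreg := hν.ae_regular hbf
  have hregY : ∀ᵐ ω ∂μ, (Y ω).Regular := ae_of_ae_map hY.aemeasurable hreg
  have hρ : IsProbabilityMeasure ((μ.map Y).map Network.simplex) :=
    Measure.isProbabilityMeasure_map measurable_simplex.aemeasurable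
  refine ⟨⟨Simplex × (ℕ → List ℕ), inferInstance, (μ.map Y).map Network.simplex ⊗ₘ iidKernel,
    Prod.fst, Prod.snd, inferInstance, iidGiven_compProd _, hν.map_network_eq hreg,
    ae_tendsto_weight _, sizeBiasedArrival_compProd _⟩, ?_, fun hinf => ?_⟩
  · filter_upwards [hregY] with ω hω k using hω.tendsto_arrivalFreq k
  · have := cond_isProbabilityMeasure hinf
    have hregc : ∀ᵐ ω ∂(μ[|{ω | (verts (Y ω).canon).Infinite}]), (Y ω).Regular :=
      cond_absolutelyContinuous.ae_le hregY
    have hne := not_ae_cond_arrivalFreq_eq_zero hY hregY hinf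
    exact ⟨fun h => hne (ae_arrivalFreq_eq_zero hY hregc (h.lintegral_eq hY)),
      fun h => hne (ae_arrivalFreq_eq_zero hY hregc (h.lintegral_eq hY hregc))⟩
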